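/- Let $C_R$ be the open cube of edge length $R$ about $0$ in $\mathbb{R}^d$, let $\ell$ be Lebesgue measure, and let $M_p$ be the set of point measures on $\mathbb{R}^d$ (Borel measures taking natural-number values on bounded Borel sets), with the $\sigma$-algebra generated by the maps $\lambda\mapsto\lambda(A)$, $A$ Borel (equivalently, the Borel $\sigma$-algebra of the vague topology). For $t\in\mathbb{R}^d$ let $T_t\lambda(A)=\lambda(-t+A)$. Let $\mu$ be a probability measure on $M_p$ which is the law of a one-colour uniformly discrete stationary ergodic point process of positive intensity; that is: - for some $r>0$, $\mu$-almost every $\lambda$ satisfies $\lambda(a+C_r)\le 1$ for all $a\in\mathbb{R}^d$; - $\mu$ is invariant under every $T_t$, and every measurable set invariant under all $T_t$ has $\mu$-measure $0$ or $1$; - the intensity $\int \lambda(C_1)\,d\mu(\lambda)/\ell(C_1)$ is positive. Assume that $\mu$-almost surely the point set $\Lambda=\{x:\lambda(\{x\})\ne 0\}$ has finite local complexity, i.e. for every $R$ there are only finitely many patches $(-x+\Lambda)\cap B_R$, $x\in\Lambda$, where $B_R$ is the open ball of radius $R$ about $0$. Let $\dot\mu$ be the (unnormalised) Palm measure of $\mu$,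 $$\dot\mu(D)=\frac{1}{\ell(B)}\int \sum_{x\in B}\lambda(\{x\})\,\mathbf 1_D(T_{-x}\lambda)\,d\mu(\lambda),$$ which does not depend on the choice of the bounded Borel set $B$ of positive volume, and let $\dot\mu_1(A)=\int\lambda(A)\,d\dot\mu(\lambda)$ be its first moment (almost surely the autocorrelation of $\lambda$). Then $\dot\mu_1$ has a unique Fourier transform $\widehat{\dot\mu_1}$ that is a positive tempered measure, i.e. there is exactly one positive tempered measure with $\widehat{\dot\mu_1}(f)=\dot\mu_1(\hat f)$ for all Schwartz functions $f$, where $\hat f(y)=\int e^{-2\pi i x\cdot y}f(x)\,dx$ and $\dot\mu_1$ is itself tempered; and for all $k,t\in\mathbb{R}^d$, $$\left|e^{2\pi i k\cdot t}-1\right|\,\widehat{\dot\mu_1}(\{k\})^{1/2}\le 2\bigl(\dot\mu_1(\{0\})-\dot\mu_1(\{t\})\bigr).$$ -/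

import Mathlib

open MeasureTheory Set
open scoped ENNReal SchwartzMap FourierTransform

/-- The space `ℝ^d` with its Euclidean distance. -/
abbrev Space (d : ℕ) : Type := EuclideanSpace ℝ (Fin d)

/-- The open cube `C_R` of edge length `R` about `0`. -/
def cube (d : ℕ) (R : ℝ) : Set (Space d) := {x | ∀ i, |x i| < R / 2}

/-- The space `M_p` of (one-colour) point measures on `ℝ^d`: the positive Borel measures whose
value on every bounded (equivalently, relatively compact) Borel set is a natural number. -/
structure PointMeasure (d : ℕ) where
  /-- the underlying Borel measure -/
  toMeasure : Measure (Space d)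
  /-- bounded Borel sets have finite integer mass -/
  exists_nat' : ∀ A : Set (Space d), MeasurableSet A → Bornology.IsBounded A →
    ∃ n : ℕ, toMeasure A = n

namespace PointMeasure

variable {d : ℕ}

/-- The σ-algebra on `M_p` generated by the evaluations `ν ↦ ν A`, `A` Borel. (On `M_p` this is
the Borel σ-algebra of the vague topology.) -/
instance : MeasurableSpace (PointMeasure d) :=
  MeasurableSpace.comap PointMeasure.toMeasure inferInstance

/-- The point set `Λ = {x | ν {x} ≠ 0}` carried by a point measure `ν`. -/
def points (ν : PointMeasure d) : Set (Space d) := {x | ν.toMeasure {x} ≠ 0}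

/-- The translate `T_t ν`, with `(T_t ν) A = ν (-t + A)`. -/
noncomputable def translate (t : Space d) (ν : PointMeasure d) : PointMeasure d where
  toMeasure := ν.toMeasure.map (fun x => t + x)
  exists_nat' A hA hb := by
    rw [Measure.map_apply (measurable_const_add t) hA]
    refine ν.exists_nat' _ (measurable_const_add t hA) ?_
    have h : (fun x => t + x) ⁻¹' A = (fun x => -t + x) '' A := by
      ext x
      constructor
      · intro hx
        exact ⟨t + x, hx, by simp⟩
      · rintro ⟨y, hy, rfl⟩
        simpa using hy
    rw [h]
    exact (isometry_add_left (-t)).lipschitz.isBounded_image hb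

end PointMeasure

/-- `ν` is `r`-uniformly discrete: every translate `a + C_r` contains at most one point. -/
def IsUniformlyDiscrete {d : ℕ} (r : ℝ) (ν : PointMeasure d) : Prop :=
  ∀ a : Space d, ν.toMeasure ((fun x => a + x) '' cube d r) ≤ 1

/-- The law `μ` of a point process is stationary: it is invariant under all translations. -/
def IsStationaryLaw {d : ℕ} (μ : Measure (PointMeasure d)) : Prop :=
  ∀ t : Space d, MeasurePreserving (PointMeasure.translate t) μ μ

/-- The law `μ` of a point process is ergodic: every measurable set that is invariant under all
translations is null or conull. -/
def IsErgodicLaw {d : ℕ} (μ : Measure (PointMeasure d)) : Prop :=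
  ∀ D : Set (PointMeasure d), MeasurableSet D →
    (∀ t : Space d, PointMeasure.translate t ⁻¹' D = D) → μ D = 0 ∨ μ Dᶜ = 0

/-- The intensity of a stationary point process: the expected number of points per unit
volume. (By stationarity the cube `C_1` may be replaced by any Borel set of positive finite
volume.) -/
noncomputable def intensity {d : ℕ} (μ : Measure (PointMeasure d)) : ℝ≥0∞ :=
  (∫⁻ ν, ν.toMeasure (cube d 1) ∂μ) / volume (cube d 1)

/-- The law `μ` on `M_p` is that of a one-colour uniformly discrete stationary ergodic point
process of positive intensity on `ℝ^d`. -/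
structure IsUniformlyDiscreteErgodicProcess {d : ℕ} (μ : Measure (PointMeasure d)) : Prop where
  isProbabilityMeasure : IsProbabilityMeasure μ
  uniformlyDiscrete : ∃ r : ℝ, 0 < r ∧ ∀ᵐ ν ∂μ, IsUniformlyDiscrete r ν
  stationary : IsStationaryLaw μ
  intensity_pos : 0 < intensity μ
  ergodic : IsErgodicLaw μ

/-- A point set has finite local complexity: for every radius `R` it has only finitely many
patches `(-x + Λ) ∩ B_R`, `x ∈ Λ`. -/
def HasFiniteLocalComplexity {d : ℕ} (Λ : Set (Space d)) : Prop :=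
  ∀ R : ℝ, {P : Set (Space d) | ∃ x ∈ Λ, P = ((fun y => -x + y) '' Λ) ∩ Metric.ball 0 R}.Finite

/-- The (unnormalised) Palm measure
`D ↦ (1 / ℓ(B)) ∫ ∑_{x ∈ B} ν {x} 1_D (T_{-x} ν) dμ(ν)`, with the choice `B = C_1`.
(By stationarity any Borel `B` of positive finite volume gives the same measure.) -/
noncomputable def palmMeasure {d : ℕ} (μ : Measure (PointMeasure d)) : Measure (PointMeasure d) :=
  (volume (cube d 1))⁻¹ • μ.bind (fun ν =>
    (ν.toMeasure.restrict (cube d 1)).map (fun x => PointMeasure.translate (-x) ν))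

/-- The first moment `A ↦ ∫ ν A dω(ν)` of a measure `ω` on `M_p`. -/
noncomputable def firstMoment {d : ℕ} (ω : Measure (PointMeasure d)) : Measure (Space d) :=
  ω.bind PointMeasure.toMeasure

/-- The positive measure `σ` is the Fourier transform of the positive measure `ω`:
both are tempered, and `σ(f) = ω(f̂)` for every rapidly decreasing `f`, where
`f̂(y) = ∫ e^{-2πi x·y} f(x) dx`. -/
structure IsFourierTransform {d : ℕ} (ω σ : Measure (Space d)) : Prop where
  temperate_left : ω.HasTemperateGrowth
  temperate_right : σ.HasTemperateGrowth
  integral_eq : ∀ f : 𝓢(Space d, ℂ), ∫ x, f x ∂σ = ∫ x, (𝓕 f) x ∂ω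

/-! ### Point measures as a kernel; measurability of translation. -/

namespace PointMeasure

open ProbabilityTheory Filter

variable {d : ℕ}

/-! Write N_φ(λ) = ∫ φ dλ and ω for the first moment of the Palm measure. Stationarity, through the
pair Campbell formula `lintegral_lintegral_lintegral_eq`, turns E|N_φ|² into an ω-integral of the
autocorrelation of φ. For φ = f̂ this reads E|N_φ|² = ∫ |f|² dσ whenever σ is a Fourier transform of
ω (`eLpNorm_linearStatistic_fourier`), and under this isometry T_t becomes multiplication by e^{-2πi
ξ·t}. Gaussians f_n shrinking to k with f_n(k) = 1 tend to the indicator of {k} in L²(σ), so their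
statistics tend in L²(μ) to an eigenfunction c with ‖c‖² = σ{k} (`exists_eigenfunction`). Ergodicity
makes |c| constant, hence E|c − c∘T_t| = |e^{2πi k·t} − 1| σ{k}^{1/2}.

For the upper bound, N_φ − N_φ∘T_t sees only the symmetric difference of Λ and t + Λ, so its
expected modulus is at most 2(ω{0} − ω{t}) ∫|φ| (`lintegral_enorm_linearStatistic_sub_add_le`). The
transform of f_n is a positive function up to a phase, so its L¹ norm is f_n(k) = 1, and letting n →
∞ gives the inequality.

Existence of σ is a Bochner–Schwartz argument. Damping ω by wide Gaussians gives measures with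
nonnegative Fourier densities, because a modulated Gaussian is a positive multiple of an
autocorrelation; these densities have uniformly bounded mass on unit balls, and a weighted weak
limit is σ. Uniqueness follows from characteristic functions after Gaussian weighting. -/

theorem measurable_toMeasure : Measurable (toMeasure : PointMeasure d → Measure (Space d)) :=
  comap_measurable _

theorem measure_ne_top (ν : PointMeasure d) {A : Set (Space d)} (hA : Bornology.IsBounded A) :
    ν.toMeasure A ≠ ∞ := by
  obtain ⟨R, hR⟩ := hA.subset_closedBall 0
  obtain ⟨n, hn⟩ := ν.exists_nat' _ Metric.isClosed_closedBall.measurableSet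
    (Metric.isBounded_closedBall (x := (0 : Space d)) (r := R))
  exact ne_top_of_le_ne_top (hn ▸ ENNReal.natCast_ne_top n) (measure_mono hR)

/-- The tautological kernel sending a point measure to itself. -/
noncomputable def kernel (d : ℕ) : Kernel (PointMeasure d) (Space d) where
  toFun := toMeasure
  measurable' := measurable_toMeasure

@[simp]
theorem kernel_apply (ν : PointMeasure d) : kernel d ν = ν.toMeasure := rfl

/-- No bounded region has mass bounded uniformly over all point measures. Splitting further by the
integer value n taken on the shell `S m` gives pieces of mass at most n, and countably many of them
sum to the kernel. -/
instance : IsSFiniteKernel (kernel d) := by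
  classical
  let S : ℕ → Set (Space d) := disjointed fun m => Metric.ball 0 (m : ℝ)
  have hS : ∀ m, MeasurableSet (S m) := fun m =>
    MeasurableSet.disjointed (fun _ => Metric.isOpen_ball.measurableSet) m
  have hSb : ∀ m, Bornology.IsBounded (S m) := fun m =>
    Metric.isBounded_ball.subset (disjointed_subset _ m)
  have hSu : ⋃ m, S m = univ := by
    rw [iUnion_disjointed]
    exact Metric.iUnion_ball_nat 0
  have hms : ∀ m n : ℕ, MeasurableSet {ν : PointMeasure d | ν.toMeasure (S m) = n} := fun m n =>
    (Measure.measurable_coe (hS m)).comp measurable_toMeasure (measurableSet_singleton _)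
  let K : ℕ × ℕ → Kernel (PointMeasure d) (Space d) := fun p =>
    Kernel.piecewise (hms p.1 p.2) ((kernel d).restrict (hS p.1)) 0
  have hK : ∀ p, IsFiniteKernel (K p) := fun p => by
    refine ⟨⟨p.2, ENNReal.natCast_lt_top _, fun ν => ?_⟩⟩
    by_cases h : ν.toMeasure (S p.1) = p.2
    · simp [K, Kernel.piecewise_apply, h, Kernel.restrict_apply]
    · simp [K, Kernel.piecewise_apply, h]
  have hsum : kernel d = Kernel.sum K := by
    ext ν A hA
    rw [Kernel.sum_apply' _ _ hA, ENNReal.tsum_prod']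
    have : ∀ m, ∑' n, K (m, n) ν A = ν.toMeasure (A ∩ S m) := by
      intro m
      obtain ⟨n, hn⟩ := ν.exists_nat' _ (hS m) (hSb m)
      rw [tsum_eq_single n]
      · simp [K, Kernel.piecewise_apply, hn, Kernel.restrict_apply, Measure.restrict_apply hA]
      · intro n' hn'
        have : ¬ ν.toMeasure (S m) = n' := by
          rw [hn]; exact_mod_cast hn'.symm
        simp [K, Kernel.piecewise_apply, this]
    simp_rw [this]
    rw [← measure_iUnion _ (fun m => hA.inter (hS m)), ← inter_iUnion, hSu, inter_univ, kernel_apply]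
    exact fun i j hij => ((disjoint_disjointed _) hij).mono inter_subset_right inter_subset_right
  rw [hsum]
  have := hK
  infer_instance

@[simp]
theorem toMeasure_translate (t : Space d) (ν : PointMeasure d) :
    (translate t ν).toMeasure = ν.toMeasure.map (fun x => t + x) := rfl

theorem lintegral_translate (t : Space d) (ν : PointMeasure d) (f : Space d → ℝ≥0∞) :
    ∫⁻ x, f x ∂(translate t ν).toMeasure = ∫⁻ x, f (t + x) ∂ν.toMeasure :=
  lintegral_map_equiv f (MeasurableEquiv.addLeft t)

theorem integral_translate (t : Space d) (ν : PointMeasure d) (f : Space d → ℂ) :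
    ∫ x, f x ∂(translate t ν).toMeasure = ∫ x, f (t + x) ∂ν.toMeasure :=
  integral_map_equiv (MeasurableEquiv.addLeft t) f

theorem translate_translate (s t : Space d) (ν : PointMeasure d) :
    translate s (translate t ν) = translate (s + t) ν := by
  cases ν
  simp only [translate, mk.injEq]
  rw [Measure.map_map (measurable_const_add s) (measurable_const_add t)]
  congr 1
  ext x
  simp [add_assoc]

theorem measurable_translate :
    Measurable fun p : Space d × PointMeasure d => translate p.1 p.2 := by
  refine measurable_comap_iff.2 (Measure.measurable_of_measurable_coe _ fun A hA => ?_)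
  let κ : Kernel (Space d × PointMeasure d) (Space d) := (kernel d).comap Prod.snd measurable_snd
  have h : ∀ p : Space d × PointMeasure d, (toMeasure ∘ fun p : Space d × PointMeasure d =>
      translate p.1 p.2) p A = κ p
        (Prod.mk p ⁻¹' {q : (Space d × PointMeasure d) × Space d | q.1.1 + q.2 ∈ A}) := by
    intro p
    simp only [Function.comp_apply, toMeasure_translate]
    rw [Measure.map_apply (measurable_const_add _) hA]
    rfl
  simp_rw [h]
  refine Kernel.measurable_kernel_prodMk_left ?_
  exact (measurable_fst.fst.add measurable_snd) hA

theorem measurable_lintegral {α : Type*} [MeasurableSpace α] {g : α → PointMeasure d}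
    (hg : Measurable g) {f : α → Space d → ℝ≥0∞} (hf : Measurable (Function.uncurry f)) :
    Measurable fun a => ∫⁻ x, f a x ∂(g a).toMeasure :=
  Measurable.lintegral_kernel_prod_right (κ := (kernel d).comap g hg) hf

instance (ν : PointMeasure d) : SFinite ν.toMeasure :=
  inferInstanceAs (SFinite (kernel d ν))

end PointMeasure

/-! ### Palm measure and the Campbell formula for pairs. -/

section Palm

open PointMeasure ProbabilityTheory

variable {d : ℕ}

theorem isOpen_cube (d : ℕ) (R : ℝ) : IsOpen (cube d R) := by
  have : cube d R = ⋂ i, {x : Space d | |x i| < R / 2} := by ext; simp [cube]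
  rw [this]
  exact isOpen_iInter_of_finite fun i => isOpen_lt (by fun_prop) continuous_const

theorem ball_subset_cube (d : ℕ) (R : ℝ) : Metric.ball 0 (R / 2) ⊆ cube d R := by
  intro x hx i
  rw [mem_ball_zero_iff] at hx
  exact (PiLp.norm_apply_le x i).trans_lt hx

theorem isBounded_cube (d : ℕ) (R : ℝ) : Bornology.IsBounded (cube d R) := by
  refine ((PiLp.antilipschitzWith_ofLp 2 fun _ : Fin d => ℝ).isBounded_preimage
    (Bornology.IsBounded.pi fun _ => Metric.isBounded_Ioo (-(R / 2)) (R / 2))).subset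
    fun x hx i _ => abs_lt.1 (hx i)

theorem volume_cube_ne_zero (d : ℕ) : volume (cube d 1) ≠ 0 :=
  ((isOpen_cube d 1).measure_pos volume ⟨0, fun i => by simp⟩).ne'

theorem volume_cube_ne_top (d : ℕ) : volume (cube d 1) ≠ ∞ :=
  (isBounded_cube d 1).measure_lt_top.ne

theorem measurable_palm_integrand :
    Measurable fun ν : PointMeasure d =>
      (ν.toMeasure.restrict (cube d 1)).map (fun x => translate (-x) ν) := by
  refine Measure.measurable_of_measurable_coe _ fun D hD => ?_
  have hm : Measurable fun p : PointMeasure d × Space d => translate (-p.2) p.1 :=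
    measurable_translate.comp (measurable_snd.neg.prodMk measurable_fst)
  have h : ∀ ν : PointMeasure d,
      (ν.toMeasure.restrict (cube d 1)).map (fun x => translate (-x) ν) D =
        kernel d ν (Prod.mk ν ⁻¹' {p : PointMeasure d × Space d |
          translate (-p.2) p.1 ∈ D ∧ p.2 ∈ cube d 1}) := by
    intro ν
    have hx : Measurable fun x => translate (-x) ν := hm.comp measurable_prodMk_left
    rw [Measure.map_apply hx hD, Measure.restrict_apply (hx hD)]
    rfl
  simp_rw [h]
  exact Kernel.measurable_kernel_prodMk_left
    ((hm hD).inter (measurable_snd (isOpen_cube d 1).measurableSet))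

theorem lintegral_palmMeasure (μ : Measure (PointMeasure d)) {F : PointMeasure d → ℝ≥0∞}
    (hF : Measurable F) :
    ∫⁻ ν, F ν ∂(palmMeasure μ) = (volume (cube d 1))⁻¹ *
      ∫⁻ ν, ∫⁻ x in cube d 1, F (translate (-x) ν) ∂ν.toMeasure ∂μ := by
  rw [palmMeasure, lintegral_smul_measure, smul_eq_mul,
    Measure.lintegral_bind measurable_palm_integrand.aemeasurable hF.aemeasurable]
  congr 1
  refine lintegral_congr fun ν => ?_
  have hx : Measurable fun x => translate (-x) ν :=
    measurable_translate.comp (measurable_neg.prodMk measurable_const)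
  rw [lintegral_map hF hx]

theorem lintegral_firstMoment_palmMeasure (μ : Measure (PointMeasure d)) {F : Space d → ℝ≥0∞}
    (hF : Measurable F) :
    ∫⁻ z, F z ∂(firstMoment (palmMeasure μ)) = (volume (cube d 1))⁻¹ *
      ∫⁻ ν, ∫⁻ x in cube d 1, ∫⁻ y, F (-x + y) ∂ν.toMeasure ∂ν.toMeasure ∂μ := by
  rw [firstMoment, Measure.lintegral_bind measurable_toMeasure.aemeasurable hF.aemeasurable,
    lintegral_palmMeasure μ (measurable_lintegral (g := fun ν => ν) measurable_id (f := fun _ x => F x)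
      (hF.comp measurable_snd))]
  simp_rw [lintegral_translate]

theorem lintegral_pairs_swap (μ : Measure (PointMeasure d)) [SFinite μ]
    {f : Space d → PointMeasure d × Space d × Space d → ℝ≥0∞}
    (hf : Measurable (Function.uncurry f)) :
    ∫⁻ ν, ∫⁻ x, ∫⁻ y, ∫⁻ s, f s (ν, x, y) ∂volume ∂ν.toMeasure ∂ν.toMeasure ∂μ =
      ∫⁻ s, ∫⁻ ν, ∫⁻ x, ∫⁻ y, f s (ν, x, y) ∂ν.toMeasure ∂ν.toMeasure ∂μ ∂volume := by
  have h3 : Measurable fun p : (PointMeasure d × Space d) × Space d =>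
      ∫⁻ y, f p.1.2 (p.1.1, p.2, y) ∂p.1.1.toMeasure :=
    measurable_lintegral measurable_fst.fst (hf.comp (measurable_fst.fst.snd.prodMk
      (measurable_fst.fst.fst.prodMk (measurable_fst.snd.prodMk measurable_snd))))
  have h2 : Measurable fun p : PointMeasure d × Space d =>
      ∫⁻ x, ∫⁻ y, f p.2 (p.1, x, y) ∂p.1.toMeasure ∂p.1.toMeasure :=
    measurable_lintegral measurable_fst h3
  rw [← lintegral_lintegral_swap h2.aemeasurable]
  refine lintegral_congr fun ν => ?_
  have h3' : Measurable fun p : Space d × Space d => ∫⁻ y, f p.2 (ν, p.1, y) ∂ν.toMeasure :=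
    h3.comp ((measurable_const.prodMk measurable_snd).prodMk measurable_fst)
  refine Eq.trans ?_ (lintegral_lintegral_swap h3'.aemeasurable)
  refine lintegral_congr fun x => ?_
  rw [lintegral_lintegral_swap]
  exact (hf.comp (measurable_snd.prodMk
    (measurable_const.prodMk (measurable_const.prodMk measurable_fst)))).aemeasurable

/-- Refined Campbell formula for pairs of points of a stationary point process. -/
theorem lintegral_lintegral_lintegral_eq {μ : Measure (PointMeasure d)} [SFinite μ]
    (hμ : IsStationaryLaw μ) {H : Space d → Space d → ℝ≥0∞}
    (hH : Measurable (Function.uncurry H)) :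
    ∫⁻ ν, ∫⁻ x, ∫⁻ y, H x y ∂ν.toMeasure ∂ν.toMeasure ∂μ =
      ∫⁻ z, ∫⁻ x, H x (x + z) ∂volume ∂(firstMoment (palmMeasure μ)) := by
  have hC := (isOpen_cube d 1).measurableSet
  let χ : Space d → ℝ≥0∞ := (cube d 1).indicator 1
  have hχ : Measurable χ := measurable_one.indicator hC
  -- The Lebesgue variable is written as s + x with x a point in the cube. Stationarity moves the
  -- shift s from H onto the cube indicator, whose integral over s is the cube's volume and cancels
  -- the Palm normalisation.
  have hshift : ∀ s : Space d, ∫⁻ ν, ∫⁻ x, ∫⁻ y, χ x * H (s + x) (s + y)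
      ∂ν.toMeasure ∂ν.toMeasure ∂μ =
      ∫⁻ ν, ∫⁻ x, ∫⁻ y, χ (-s + x) * H x y ∂ν.toMeasure ∂ν.toMeasure ∂μ := by
    intro s
    have hm : Measurable fun ν : PointMeasure d =>
        ∫⁻ x, ∫⁻ y, χ (-s + x) * H x y ∂ν.toMeasure ∂ν.toMeasure := by
      refine measurable_lintegral measurable_id (measurable_lintegral measurable_fst ?_)
      exact (hχ.comp (measurable_fst.snd.const_add _)).mul
        (hH.comp (measurable_fst.snd.prodMk measurable_snd))
    rw [← (hμ s).lintegral_comp hm]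
    simp_rw [lintegral_translate, neg_add_cancel_left]
  rw [lintegral_firstMoment_palmMeasure μ (by
    exact Measurable.lintegral_prod_right' (f := fun p : Space d × Space d => H p.2 (p.2 + p.1))
      (hH.comp (measurable_snd.prodMk (measurable_snd.add measurable_fst))))]
  have hr : ∀ ν : PointMeasure d,
      ∫⁻ x in cube d 1, ∫⁻ y, ∫⁻ x', H x' (x' + (-x + y)) ∂volume ∂ν.toMeasure ∂ν.toMeasure =
      ∫⁻ x, ∫⁻ y, ∫⁻ s, χ x * H (s + x) (s + y) ∂volume ∂ν.toMeasure ∂ν.toMeasure := by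
    intro ν
    rw [← lintegral_indicator hC]
    refine lintegral_congr fun x => ?_
    by_cases hx : x ∈ cube d 1
    · simp only [hx, indicator_of_mem, χ, Pi.one_apply, one_mul]
      refine lintegral_congr fun y => ?_
      rw [← lintegral_add_right_eq_self _ x]
      simp [add_assoc]
    · simp [hx, χ]
  simp_rw [hr]
  rw [lintegral_pairs_swap μ (f := fun s p => χ p.2.1 * H (s + p.2.1) (s + p.2.2)) (by
    exact (hχ.comp measurable_snd.snd.fst).mul (hH.comp ((measurable_fst.add
      measurable_snd.snd.fst).prodMk (measurable_fst.add measurable_snd.snd.snd))))]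
  simp_rw [hshift]
  rw [← lintegral_pairs_swap μ (f := fun s p => χ (-s + p.2.1) * H p.2.1 p.2.2) (by
    exact (hχ.comp (measurable_fst.neg.add measurable_snd.snd.fst)).mul
      (hH.comp (measurable_snd.snd.fst.prodMk measurable_snd.snd.snd)))]
  have hs : ∀ x y : Space d, ∫⁻ s, χ (-s + x) * H x y = volume (cube d 1) * H x y := by
    intro x y
    have hχx : Measurable fun s => χ (-s + x) := hχ.comp (measurable_neg.add_const x)
    rw [lintegral_mul_const _ hχx]
    congr 1
    have := lintegral_sub_left_eq_self (μ := (volume : Measure (Space d))) χ x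
    simp_rw [sub_eq_neg_add] at this
    rw [this, lintegral_indicator_one hC]
  simp_rw [hs]
  have hm : Measurable fun ν : PointMeasure d => ∫⁻ x, ∫⁻ y, H x y ∂ν.toMeasure ∂ν.toMeasure :=
    measurable_lintegral measurable_id (measurable_lintegral measurable_fst
      (hH.comp (measurable_fst.snd.prodMk measurable_snd)))
  have hm2 : ∀ ν : PointMeasure d, Measurable fun x => ∫⁻ y, H x y ∂ν.toMeasure := fun ν =>
    Measurable.lintegral_prod_right hH
  have hm3 : ∀ x, Measurable fun y => H x y := fun x => hH.comp measurable_prodMk_left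
  simp_rw [lintegral_const_mul _ (hm3 _), lintegral_const_mul _ (hm2 _),
    lintegral_const_mul _ hm]
  rw [← mul_assoc, ENNReal.inv_mul_cancel (volume_cube_ne_zero d) (volume_cube_ne_top d), one_mul]

end Palm

/-! ### Translation-bounded measures and polynomial weights. -/

section TranslationBounded

open Filter Topology

variable {d : ℕ}

/-- A measure whose mass on balls of radius `δ` is at most `C` is dominated by Lebesgue measure
at scale `δ`. -/
theorem volume_ball_mul_lintegral_le {ρ : Measure (Space d)} [SFinite ρ] {δ : ℝ} {C : ℝ≥0∞}
    (hρ : ∀ a, ρ (Metric.ball a δ) ≤ C) {F F' : Space d → ℝ≥0∞} (hF : Measurable F)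
    (hF' : Measurable F') (h : ∀ x y, dist x y < δ → F y ≤ F' x) :
    volume (Metric.ball (0 : Space d) δ) * ∫⁻ y, F y ∂ρ ≤ C * ∫⁻ x, F' x := by
  classical
  let S : Set (Space d × Space d) := {p | dist p.1 p.2 < δ}
  have hS : MeasurableSet S := (isOpen_lt continuous_dist continuous_const).measurableSet
  have hχ : Measurable (S.indicator (1 : Space d × Space d → ℝ≥0∞)) := measurable_one.indicator hS
  calc volume (Metric.ball (0 : Space d) δ) * ∫⁻ y, F y ∂ρ
      = ∫⁻ y, ∫⁻ x, S.indicator 1 (x, y) * F y ∂volume ∂ρ := by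
        rw [← lintegral_const_mul _ hF]
        refine lintegral_congr fun y => ?_
        have h1 : Measurable fun x => S.indicator (1 : Space d × Space d → ℝ≥0∞) (x, y) :=
          hχ.comp measurable_prodMk_right
        rw [lintegral_mul_const _ h1]
        congr 1
        have h2 : (fun x => S.indicator (1 : Space d × Space d → ℝ≥0∞) (x, y)) =
            (Metric.ball y δ).indicator 1 := by
          ext x; simp [S, indicator_apply]
        rw [h2, lintegral_indicator_one Metric.isOpen_ball.measurableSet,
          Measure.addHaar_ball_center volume y]
    _ = ∫⁻ x, ∫⁻ y, S.indicator 1 (x, y) * F y ∂ρ ∂volume := by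
        rw [lintegral_lintegral_swap]
        exact ((hχ.comp measurable_swap).mul (hF.comp measurable_fst)).aemeasurable
    _ ≤ ∫⁻ x, C * F' x := by
        refine lintegral_mono fun x => ?_
        calc ∫⁻ y, S.indicator 1 (x, y) * F y ∂ρ
            ≤ ∫⁻ y, (Metric.ball x δ).indicator 1 y * F' x ∂ρ := by
              refine lintegral_mono fun y => ?_
              by_cases hy : dist x y < δ
              · have hy' : y ∈ Metric.ball x δ := by rwa [Metric.mem_ball, dist_comm]
                simp only [S, indicator_apply, mem_ofPred_eq, hy, hy', if_true, Pi.one_apply,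
                  one_mul]
                exact h x y hy
              · simp [S, indicator_apply, hy]
          _ = ρ (Metric.ball x δ) * F' x := by
              rw [lintegral_mul_const _ (measurable_one.indicator Metric.isOpen_ball.measurableSet),
                lintegral_indicator_one Metric.isOpen_ball.measurableSet]
          _ ≤ C * F' x := by gcongr; exact hρ x
    _ = C * ∫⁻ x, F' x := lintegral_const_mul _ hF'

/-- Comparison of the indicators of concentric balls of radii R and R + δ. The bound is uniform in
ρ, so it serves all samples of the process at once. -/
theorem exists_measure_le_of_isBounded {A : Set (Space d)} (hA : Bornology.IsBounded A) {δ : ℝ}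
    (hδ : 0 < δ) {C : ℝ≥0∞} (hC : C ≠ ∞) :
    ∃ M : ℝ≥0∞, M ≠ ∞ ∧ ∀ ρ : Measure (Space d), SFinite ρ → (∀ a, ρ (Metric.ball a δ) ≤ C) →
      ρ A ≤ M := by
  obtain ⟨R, hR⟩ := hA.subset_closedBall 0
  have hb : volume (Metric.ball (0 : Space d) δ) ≠ 0 := (Metric.measure_ball_pos _ _ hδ).ne'
  have hb' : volume (Metric.ball (0 : Space d) δ) ≠ ∞ := measure_ball_lt_top.ne
  refine ⟨C * volume (Metric.closedBall (0 : Space d) (R + δ)) /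
    volume (Metric.ball (0 : Space d) δ), ENNReal.div_ne_top (ENNReal.mul_ne_top hC
      measure_closedBall_lt_top.ne) hb, fun ρ _ hρ => ?_⟩
  refine (measure_mono hR).trans ?_
  rw [ENNReal.le_div_iff_mul_le (Or.inl hb) (Or.inl hb'), mul_comm]
  have := volume_ball_mul_lintegral_le hρ (F := (Metric.closedBall 0 R).indicator 1)
    (F' := (Metric.closedBall 0 (R + δ)).indicator 1)
    (measurable_one.indicator Metric.isClosed_closedBall.measurableSet)
    (measurable_one.indicator Metric.isClosed_closedBall.measurableSet) (by
      intro x y hxy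
      by_cases hy : y ∈ Metric.closedBall (0 : Space d) R
      · have hx : x ∈ Metric.closedBall (0 : Space d) (R + δ) := by
          rw [Metric.mem_closedBall] at hy ⊢
          linarith [dist_triangle x y 0]
        simp only [indicator_of_mem hy, indicator_of_mem hx, Pi.one_apply, le_refl]
      · rw [indicator_of_notMem hy]
        exact zero_le)
  rwa [lintegral_indicator_one Metric.isClosed_closedBall.measurableSet,
    lintegral_indicator_one Metric.isClosed_closedBall.measurableSet] at this

/-- The weight `(1 + ‖x‖)^(-(d + 1))`. -/
noncomputable def polyWeight (d : ℕ) (x : Space d) : ℝ := (1 + ‖x‖) ^ (-((d + 1 : ℕ) : ℝ))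

theorem polyWeight_pos (x : Space d) : 0 < polyWeight d x := by
  have : 0 ≤ ‖x‖ := norm_nonneg x
  exact Real.rpow_pos_of_pos (by positivity) _

theorem continuous_polyWeight : Continuous (polyWeight d) :=
  (by fun_prop : Continuous fun x : Space d => 1 + ‖x‖).rpow_const fun x =>
    Or.inl (by positivity)

theorem integrable_polyWeight : Integrable (polyWeight d) := by
  have := integrable_one_add_norm (E := Space d) (μ := volume) (r := ((d + 1 : ℕ) : ℝ)) (by simp)
  exact this

/-- The weight varies slowly at scale δ, as `volume_ball_mul_lintegral_le` requires. -/
theorem polyWeight_le {x y : Space d} {δ : ℝ} (h : dist x y < δ) :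
    polyWeight d y ≤ (1 + δ) ^ (d + 1) * polyWeight d x := by
  have hδ : 0 < δ := dist_nonneg.trans_lt h
  have hx := norm_nonneg x
  have hy := norm_nonneg y
  have h1 : 1 + ‖x‖ ≤ (1 + δ) * (1 + ‖y‖) := by
    have : ‖x‖ ≤ ‖y‖ + dist x y := by
      rw [dist_eq_norm]; exact norm_le_norm_add_norm_sub y x |>.trans (by rw [norm_sub_rev])
    nlinarith
  simp only [polyWeight, Real.rpow_neg (by positivity : 0 ≤ 1 + ‖x‖),
    Real.rpow_neg (by positivity : 0 ≤ 1 + ‖y‖), Real.rpow_natCast]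
  rw [← div_eq_mul_inv, le_div_iff₀ (by positivity), inv_mul_le_iff₀ (by positivity), mul_comm,
    ← mul_pow]
  exact pow_le_pow_left₀ (by positivity) h1 _

/-- Measures with uniformly bounded mass on balls of radius `δ` are uniformly tight with respect
to the weight `polyWeight d`. -/
theorem exists_setLIntegral_polyWeight_le {δ : ℝ} (hδ : 0 < δ) {C : ℝ≥0∞} (hC : C ≠ ∞) :
    ∃ u : ℕ → ℝ≥0∞, (∀ n, u n ≠ ∞) ∧ Tendsto u atTop (𝓝 0) ∧
      ∀ ρ : Measure (Space d), SFinite ρ → (∀ a, ρ (Metric.ball a δ) ≤ C) → ∀ n : ℕ,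
        ∫⁻ x in (Metric.closedBall 0 (n : ℝ))ᶜ, ENNReal.ofReal (polyWeight d x) ∂ρ ≤ u n := by
  have hb : volume (Metric.ball (0 : Space d) δ) ≠ 0 := (Metric.measure_ball_pos _ _ hδ).ne'
  have hb' : volume (Metric.ball (0 : Space d) δ) ≠ ∞ := measure_ball_lt_top.ne
  have hWm : Measurable fun x => ENNReal.ofReal (polyWeight d x) :=
    continuous_polyWeight.measurable.ennreal_ofReal
  have hW : ∫⁻ x, ENNReal.ofReal (polyWeight d x) ≠ ∞ := by
    have := integrable_polyWeight (d := d).hasFiniteIntegral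
    rw [hasFiniteIntegral_iff_ofReal (ae_of_all _ fun x => (polyWeight_pos x).le)] at this
    exact this.ne
  -- A point within δ of the complement of the ball of radius n lies outside the ball of radius n −
  -- δ.
  let T : ℕ → Set (Space d) := fun n => (Metric.closedBall 0 ((n : ℝ) - δ))ᶜ
  have hT : ∀ n, MeasurableSet (T n) := fun n => Metric.isClosed_closedBall.measurableSet.compl
  let K : ℝ≥0∞ := C * ENNReal.ofReal ((1 + δ) ^ (d + 1)) / volume (Metric.ball (0 : Space d) δ)
  have hK : K ≠ ∞ := ENNReal.div_ne_top (ENNReal.mul_ne_top hC ENNReal.ofReal_ne_top) hb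
  have hfin : ∀ n, ∫⁻ x in T n, ENNReal.ofReal (polyWeight d x) ≠ ∞ := fun n =>
    ne_top_of_le_ne_top hW (setLIntegral_le_lintegral _ _)
  refine ⟨fun n => K * ∫⁻ x in T n, ENNReal.ofReal (polyWeight d x),
    fun n => ENNReal.mul_ne_top hK (hfin n), ?_, fun ρ _ hρ n => ?_⟩
  · rw [← mul_zero K]
    refine ENNReal.Tendsto.const_mul ?_ (Or.inr hK)
    have := isFiniteMeasure_withDensity hW
    have hanti : Antitone T := fun m n hmn =>
      compl_subset_compl.2 (Metric.closedBall_subset_closedBall (by gcongr))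
    have hi : ⋂ n, T n = ∅ := by
      refine eq_empty_of_forall_notMem fun x hx => ?_
      obtain ⟨n, hn⟩ := exists_nat_ge (dist x 0 + δ)
      refine mem_iInter.1 hx n ?_
      rw [Metric.mem_closedBall]
      linarith
    have := tendsto_measure_iInter_atTop
      (μ := volume.withDensity fun x : Space d => ENNReal.ofReal (polyWeight d x))
      (fun n => (hT n).nullMeasurableSet) hanti ⟨0, measure_ne_top _ _⟩
    rw [hi, measure_empty] at this
    refine this.congr fun n => ?_
    rw [Function.comp_apply, withDensity_apply _ (hT n)]
  · have hc := Metric.isClosed_closedBall (x := (0 : Space d)) (ε := (n : ℝ))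
    rw [← lintegral_indicator hc.measurableSet.compl]
    have := volume_ball_mul_lintegral_le hρ
      (F := (Metric.closedBall 0 (n : ℝ))ᶜ.indicator fun x => ENNReal.ofReal (polyWeight d x))
      (F' := (T n).indicator fun x => ENNReal.ofReal ((1 + δ) ^ (d + 1)) *
        ENNReal.ofReal (polyWeight d x))
      (hWm.indicator hc.measurableSet.compl) ((hWm.const_mul _).indicator (hT n)) (by
        intro x y hxy
        by_cases hy : y ∈ (Metric.closedBall (0 : Space d) (n : ℝ))ᶜ
        · have hx : x ∈ T n := by
            simp only [T, mem_compl_iff, Metric.mem_closedBall, not_le] at hy ⊢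
            have := dist_triangle y x 0
            rw [dist_comm y x] at this
            linarith
          rw [indicator_of_mem hy, indicator_of_mem hx, ← ENNReal.ofReal_mul (by positivity)]
          exact ENNReal.ofReal_le_ofReal (polyWeight_le hxy)
        · rw [indicator_of_notMem hy]
          exact zero_le)
    rw [lintegral_indicator (hT n), lintegral_const_mul _ hWm, ← mul_assoc, mul_comm] at this
    rw [← ENNReal.le_div_iff_mul_le (Or.inl hb) (Or.inl hb')] at this
    refine this.trans_eq ?_
    simp only [K, div_eq_mul_inv]
    ring

theorem exists_lintegral_polyWeight_le {δ : ℝ} (hδ : 0 < δ) {C : ℝ≥0∞} (hC : C ≠ ∞) :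
    ∃ K : ℝ≥0∞, K ≠ ∞ ∧ ∀ ρ : Measure (Space d), SFinite ρ → (∀ a, ρ (Metric.ball a δ) ≤ C) →
      ∫⁻ x, ENNReal.ofReal (polyWeight d x) ∂ρ ≤ K := by
  obtain ⟨u, hu, -, h⟩ := exists_setLIntegral_polyWeight_le (d := d) hδ hC
  obtain ⟨M, hM, h'⟩ := exists_measure_le_of_isBounded (A := Metric.closedBall (0 : Space d) (0 : ℕ))
    Metric.isBounded_closedBall hδ hC
  refine ⟨M + u 0, ENNReal.add_ne_top.2 ⟨hM, hu 0⟩, fun ρ hs hρ => ?_⟩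
  rw [← lintegral_add_compl _ (Metric.isClosed_closedBall (x := (0 : Space d))
    (ε := ((0 : ℕ) : ℝ))).measurableSet]
  refine add_le_add ?_ (h ρ hs hρ 0)
  refine (lintegral_mono (g := 1) fun x => ?_).trans (by simpa using h' ρ hs hρ)
  refine ENNReal.ofReal_le_one.2 (Real.rpow_le_one_of_one_le_of_nonpos ?_ ?_)
  · linarith [norm_nonneg x]
  · exact neg_nonpos.2 (Nat.cast_nonneg _)

theorem hasTemperateGrowth_of_lintegral_polyWeight {ρ : Measure (Space d)}
    (h : ∫⁻ x, ENNReal.ofReal (polyWeight d x) ∂ρ ≠ ∞) : ρ.HasTemperateGrowth := by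
  refine ⟨⟨d + 1, ?_⟩⟩
  refine ⟨continuous_polyWeight.aestronglyMeasurable, ?_⟩
  change HasFiniteIntegral (polyWeight d) ρ
  rw [hasFiniteIntegral_iff_ofReal (ae_of_all _ fun x => (polyWeight_pos x).le)]
  exact h.lt_top

/-- Schwartz functions are dominated by `polyWeight d`. -/
theorem SchwartzMap.exists_norm_le_polyWeight (f : 𝓢(Space d, ℂ)) :
    ∃ C : ℝ, 0 ≤ C ∧ ∀ x, ‖f x‖ ≤ C * polyWeight d x := by
  refine ⟨2 ^ (d + 1) * ((Finset.Iic (d + 1, 0)).sup fun m => SchwartzMap.seminorm ℝ m.1 m.2) f,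
    by positivity, fun x => ?_⟩
  have := one_add_le_sup_seminorm_apply (𝕜 := ℝ) (m := (d + 1, 0)) le_rfl le_rfl f x
  have hx : 0 < 1 + ‖x‖ := by positivity
  rw [polyWeight, Real.rpow_neg hx.le, Real.rpow_natCast, ← div_eq_mul_inv,
    le_div_iff₀ (by positivity), mul_comm]
  simpa using this

end TranslationBounded

/-! ### Uniform ball bounds for samples and for the autocorrelation. -/

section UniformlyDiscrete

open PointMeasure

variable {d : ℕ}

theorem IsUniformlyDiscrete.measure_ball_le {r : ℝ} {ν : PointMeasure d}
    (h : IsUniformlyDiscrete r ν) (a : Space d) : ν.toMeasure (Metric.ball a (r / 2)) ≤ 1 := by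
  refine (measure_mono fun x hx => ?_).trans (h a)
  refine ⟨-a + x, ball_subset_cube d r ?_, by simp⟩
  rw [mem_ball_zero_iff]
  rwa [Metric.mem_ball, dist_eq_norm, sub_eq_neg_add] at hx

/-- The autocorrelation of a uniformly discrete process is translation bounded. -/
theorem exists_firstMoment_ball_le {μ : Measure (PointMeasure d)} [IsProbabilityMeasure μ] {r : ℝ}
    (hr : 0 < r) (hμ : ∀ᵐ ν ∂μ, IsUniformlyDiscrete r ν) :
    ∃ C : ℝ≥0∞, C ≠ ∞ ∧ ∀ a, firstMoment (palmMeasure μ) (Metric.ball a (r / 2)) ≤ C := by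
  obtain ⟨M, hM, h⟩ := exists_measure_le_of_isBounded (isBounded_cube d 1) (half_pos hr)
    ENNReal.one_ne_top
  refine ⟨(volume (cube d 1))⁻¹ * M, ENNReal.mul_ne_top
    (ENNReal.inv_ne_top.2 (volume_cube_ne_zero d)) hM, fun a => ?_⟩
  rw [← lintegral_indicator_one Metric.isOpen_ball.measurableSet,
    lintegral_firstMoment_palmMeasure μ (measurable_one.indicator Metric.isOpen_ball.measurableSet)]
  gcongr
  calc _ ≤ ∫⁻ _, M ∂μ := by
        refine lintegral_mono_ae (hμ.mono fun ν hν => ?_)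
        refine (lintegral_mono (g := 1) fun x => ?_).trans
          (by simpa using h ν.toMeasure inferInstance hν.measure_ball_le)
        have : (fun y => (Metric.ball a (r / 2)).indicator (1 : Space d → ℝ≥0∞) (-x + y)) =
            (Metric.ball (x + a) (r / 2)).indicator 1 := by
          classical
          ext y
          simp only [indicator_apply, Metric.mem_ball, dist_eq_norm]
          rw [show -x + y - a = y - (x + a) by abel]
          rfl
        rw [this, lintegral_indicator_one Metric.isOpen_ball.measurableSet]
        exact hν.measure_ball_le _
    _ = M := by simp

theorem isLocallyFiniteMeasure_of_measure_ball_le {ρ : Measure (Space d)} {δ : ℝ} (hδ : 0 < δ)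
    {C : ℝ≥0∞} (hC : C ≠ ∞) (hρ : ∀ a, ρ (Metric.ball a δ) ≤ C) : IsLocallyFiniteMeasure ρ :=
  ⟨fun x => ⟨_, Metric.ball_mem_nhds x hδ, (hρ x).trans_lt hC.lt_top⟩⟩

end UniformlyDiscrete

/-! ### Gaussians as Schwartz functions. -/

section Gaussian

variable {d : ℕ}

/-- From (1 + r)^m ≤ m! e^{1+r} and, completing the square, r − a r² ≤ 1/(4a). -/
theorem exists_pow_mul_exp_neg_mul_sq_le {a : ℝ} (ha : 0 < a) (m : ℕ) :
    ∃ C : ℝ, ∀ r : ℝ, 0 ≤ r → (1 + r) ^ m * Real.exp (-a * r ^ 2) ≤ C := by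
  refine ⟨m.factorial * Real.exp (1 + 1 / (4 * a)), fun r hr => ?_⟩
  have h1 := Real.pow_div_factorial_le_exp (1 + r) (by positivity) m
  rw [div_le_iff₀ (by positivity)] at h1
  have h2 : 1 + r - a * r ^ 2 ≤ 1 + 1 / (4 * a) := by
    have h3 : 1 / (4 * a) - r + a * r ^ 2 = (2 * a * r - 1) ^ 2 / (4 * a) := by
      field_simp; ring
    have : 0 ≤ (2 * a * r - 1) ^ 2 / (4 * a) := by positivity
    linarith
  calc (1 + r) ^ m * Real.exp (-a * r ^ 2)
      ≤ Real.exp (1 + r) * m.factorial * Real.exp (-a * r ^ 2) := by gcongr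
    _ = m.factorial * Real.exp (1 + r - a * r ^ 2) := by
        rw [mul_comm (Real.exp _), mul_assoc, ← Real.exp_add]; ring_nf
    _ ≤ _ := by gcongr

/-- The real Gaussian `x ↦ exp (-a ‖x‖²)` as a Schwartz function. -/
noncomputable def gaussianReal (a : ℝ) (ha : 0 < a) : 𝓢(Space d, ℝ) where
  toFun x := Real.exp (-a * ‖x‖ ^ 2)
  smooth' := by
    have : ContDiff ℝ (⊤ : ℕ∞) fun x : Space d => ‖x‖ ^ 2 := contDiff_norm_sq ℝ
    exact Real.contDiff_exp.comp (contDiff_const.mul this)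
  decay' k n := by
    have hq : (fun x : Space d => -a * ‖x‖ ^ 2).HasTemperateGrowth :=
      (Function.HasTemperateGrowth.const (-a)).mul (Function.hasTemperateGrowth_norm_sq _)
    obtain ⟨K, C, hC, hD⟩ := hq.norm_iteratedFDeriv_le_uniform n
    obtain ⟨B, hB⟩ := exists_pow_mul_exp_neg_mul_sq_le ha (k + K * n)
    refine ⟨n.factorial * (C + 1) ^ n * B, fun x => ?_⟩
    have hx := norm_nonneg x
    -- The composition bound wants the i-th derivative controlled by the i-th power of one base.
    -- Using C + 1 in place of C makes the base at least 1, so its first power suffices for every i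
    -- ≥ 1.
    have h1 : 1 ≤ (C + 1) * (1 + ‖x‖) ^ K :=
      one_le_mul_of_one_le_of_one_le (by linarith) (one_le_pow₀ (by linarith))
    have h := norm_iteratedFDeriv_comp_le (𝕜 := ℝ) (g := Real.exp) (n := n) (N := (⊤ : ℕ∞))
      (f := fun x : Space d => -a * ‖x‖ ^ 2) Real.contDiff_exp hq.1 (by exact_mod_cast le_top) x
      (C := Real.exp (-a * ‖x‖ ^ 2)) (D := (C + 1) * (1 + ‖x‖) ^ K)
      (fun i _ => by
        rw [norm_iteratedFDeriv_eq_norm_iteratedDeriv, iteratedDeriv_eq_iterate,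
          Real.iter_deriv_exp, Real.norm_eq_abs, Real.abs_exp])
      (fun i hi hin => by
        refine (hD i hin x).trans ?_
        calc C * (1 + ‖x‖) ^ K ≤ (C + 1) * (1 + ‖x‖) ^ K := by gcongr; linarith
          _ ≤ _ := le_self_pow₀ h1 (by omega))
    calc ‖x‖ ^ k * ‖iteratedFDeriv ℝ n (fun x : Space d => Real.exp (-a * ‖x‖ ^ 2)) x‖
        ≤ (1 + ‖x‖) ^ k * (n.factorial * Real.exp (-a * ‖x‖ ^ 2) *
          ((C + 1) * (1 + ‖x‖) ^ K) ^ n) := by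
          gcongr
          · linarith
          · exact h
      _ = n.factorial * (C + 1) ^ n * ((1 + ‖x‖) ^ (k + K * n) * Real.exp (-a * ‖x‖ ^ 2)) := by
          rw [pow_add, mul_pow, ← pow_mul]; ring
      _ ≤ _ := by gcongr; exact hB _ hx

/-- The Gaussian `x ↦ exp (-a ‖x‖²)` as a complex-valued Schwartz function. -/
noncomputable def gaussian (a : ℝ) (ha : 0 < a) : 𝓢(Space d, ℂ) :=
  (gaussianReal a ha).postcompCLM Complex.ofRealCLM

theorem gaussian_apply (a : ℝ) (ha : 0 < a) (x : Space d) :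
    gaussian a ha x = (Real.exp (-a * ‖x‖ ^ 2) : ℝ) := rfl

theorem norm_gaussian_apply (a : ℝ) (ha : 0 < a) (x : Space d) :
    ‖gaussian a ha x‖ = Real.exp (-a * ‖x‖ ^ 2) := by
  rw [gaussian_apply, Complex.norm_real, Real.norm_eq_abs, Real.abs_exp]

/-- The transform is nonnegative, so its L¹ norm is its integral, which Fourier inversion identifies
with the Gaussian's value at 0. This normalisation yields the exact constant of the final
inequality. -/
theorem integral_norm_fourier_gaussian (a : ℝ) (ha : 0 < a) :
    ∫ x : Space d, ‖𝓕 (gaussian a ha : 𝓢(Space d, ℂ)) x‖ = 1 := by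
  have h : ∀ x : Space d, 𝓕 (gaussian a ha : 𝓢(Space d, ℂ)) x =
      ((Real.pi / a) ^ ((d : ℝ) / 2) * Real.exp (-Real.pi ^ 2 * ‖x‖ ^ 2 / a) : ℝ) := by
    intro x
    have := fourier_gaussian_innerProductSpace (V := Space d) (b := (a : ℂ)) (by simpa) x
    have hg : ⇑(gaussian a ha : 𝓢(Space d, ℂ)) = fun v => Complex.exp (-a * ‖v‖ ^ 2) := by
      ext v
      simp [gaussian_apply]
    rw [SchwartzMap.fourier_coe, hg]
    convert this using 1
    · simp only [finrank_euclideanSpace, Fintype.card_fin]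
      push_cast
      rw [Complex.ofReal_cpow (by positivity)]
      push_cast
      rfl
  have h1 : ∀ x : Space d, (‖𝓕 (gaussian a ha : 𝓢(Space d, ℂ)) x‖ : ℂ) =
      𝓕 (gaussian a ha : 𝓢(Space d, ℂ)) x := by
    intro x
    rw [h x, Complex.norm_real, Real.norm_of_nonneg (by positivity)]
  have h2 : 𝓕⁻ (𝓕 (gaussian a ha : 𝓢(Space d, ℂ))) (0 : Space d) = 1 := by
    rw [FourierTransform.fourierInv_fourier_eq, gaussian_apply]
    simp
  rw [SchwartzMap.fourierInv_coe, Real.fourierInv_eq] at h2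
  simp only [inner_zero_right, AddChar.map_zero_eq_one, one_smul] at h2
  rw [← Complex.ofReal_inj, ← integral_complex_ofReal]
  simp_rw [h1]
  simpa using h2

end Gaussian

/-! ### Modulation as the Fourier dual of translation. -/

section Modulation

variable {d : ℕ}

/-- The modulated function `ξ ↦ exp (-2πi ξ·t) f ξ`. -/
noncomputable def modulate (t : Space d) (f : 𝓢(Space d, ℂ)) : 𝓢(Space d, ℂ) :=
  𝓕⁻ (SchwartzMap.compSubConstCLM ℂ (-t) (𝓕 f))

theorem fourier_modulate_apply (t : Space d) (f : 𝓢(Space d, ℂ)) (x : Space d) :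
    𝓕 (modulate t f) x = 𝓕 f (x + t) := by
  rw [modulate, FourierTransform.fourier_fourierInv_eq, SchwartzMap.compSubConstCLM_apply,
    sub_neg_eq_add]

theorem modulate_apply (t : Space d) (f : 𝓢(Space d, ℂ)) (ξ : Space d) :
    modulate t f ξ = Real.fourierChar (-inner ℝ ξ t) * f ξ := by
  have h : f ξ = 𝓕⁻ (𝓕 f) ξ := by rw [FourierTransform.fourierInv_fourier_eq]
  rw [h, modulate, SchwartzMap.fourierInv_coe, SchwartzMap.fourierInv_coe, Real.fourierInv_eq,
    Real.fourierInv_eq, ← integral_sub_right_eq_self _ t, ← integral_const_mul]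
  refine integral_congr_ae (ae_of_all _ fun v => ?_)
  have e : Real.fourierChar (inner ℝ (v - t) ξ) =
      Real.fourierChar (-inner ℝ ξ t) * Real.fourierChar (inner ℝ v ξ) := by
    rw [inner_sub_left, sub_eq_neg_add, AddChar.map_add_eq_mul, real_inner_comm t ξ]
  simp only [SchwartzMap.compSubConstCLM_apply, sub_neg_eq_add, sub_add_cancel, e,
    Circle.smul_def, Circle.coe_mul, smul_eq_mul, mul_assoc]

end Modulation

/-! ### Linear statistics and the isometry with L²(σ). -/

section LinearStatistics

open PointMeasure ProbabilityTheory

variable {d : ℕ}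

/-- The linear statistic `ν ↦ ∫ φ dν` of a point measure. -/
noncomputable def linearStatistic (φ : 𝓢(Space d, ℂ)) (ν : PointMeasure d) : ℂ :=
  ∫ x, φ x ∂ν.toMeasure

theorem stronglyMeasurable_linearStatistic (φ : 𝓢(Space d, ℂ)) :
    StronglyMeasurable (linearStatistic φ) :=
  StronglyMeasurable.integral_kernel (κ := kernel d) φ.continuous.stronglyMeasurable

theorem IsUniformlyDiscrete.hasTemperateGrowth {r : ℝ} (hr : 0 < r) {ν : PointMeasure d}
    (h : IsUniformlyDiscrete r ν) : ν.toMeasure.HasTemperateGrowth := by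
  obtain ⟨K, hK, hK'⟩ := exists_lintegral_polyWeight_le (d := d) (half_pos hr) ENNReal.one_ne_top
  exact hasTemperateGrowth_of_lintegral_polyWeight
    (ne_top_of_le_ne_top hK (hK' _ inferInstance h.measure_ball_le))

theorem SchwartzMap.exists_lintegral_enorm_le (φ : 𝓢(Space d, ℂ)) {δ : ℝ} (hδ : 0 < δ) {C : ℝ≥0∞}
    (hC : C ≠ ∞) : ∃ B : ℝ≥0∞, B ≠ ∞ ∧ ∀ ρ : Measure (Space d), SFinite ρ →
      (∀ a, ρ (Metric.ball a δ) ≤ C) → ∫⁻ x, ‖φ x‖ₑ ∂ρ ≤ B := by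
  obtain ⟨K, hK, hK'⟩ := exists_lintegral_polyWeight_le (d := d) hδ hC
  obtain ⟨M, hM, hφ⟩ := φ.exists_norm_le_polyWeight
  refine ⟨ENNReal.ofReal M * K, ENNReal.mul_ne_top ENNReal.ofReal_ne_top hK, fun ρ hs hρ => ?_⟩
  calc ∫⁻ x, ‖φ x‖ₑ ∂ρ ≤ ∫⁻ x, ENNReal.ofReal M * ENNReal.ofReal (polyWeight d x) ∂ρ := by
        refine lintegral_mono fun x => ?_
        rw [← ENNReal.ofReal_mul hM, ← ofReal_norm]
        exact ENNReal.ofReal_le_ofReal (hφ x)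
    _ = ENNReal.ofReal M * ∫⁻ x, ENNReal.ofReal (polyWeight d x) ∂ρ :=
        lintegral_const_mul _ continuous_polyWeight.measurable.ennreal_ofReal
    _ ≤ _ := by gcongr; exact hK' ρ hs hρ

theorem linearStatistic_translate (φ : 𝓢(Space d, ℂ)) (t : Space d) (ν : PointMeasure d) :
    linearStatistic φ (translate t ν) =
      linearStatistic (SchwartzMap.compSubConstCLM ℂ (-t) φ) ν := by
  rw [linearStatistic, integral_translate]
  refine integral_congr_ae (ae_of_all _ fun x => ?_)
  simp [add_comm]

variable {μ : Measure (PointMeasure d)} [IsProbabilityMeasure μ] {r : ℝ}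

theorem sFinite_firstMoment_palmMeasure (hr : 0 < r) (hud : ∀ᵐ ν ∂μ, IsUniformlyDiscrete r ν) :
    SFinite (firstMoment (palmMeasure μ)) := by
  obtain ⟨C, hC, h⟩ := exists_firstMoment_ball_le hr hud
  have := isLocallyFiniteMeasure_of_measure_ball_le (half_pos hr) hC h
  infer_instance

theorem hasTemperateGrowth_firstMoment_palmMeasure (hr : 0 < r)
    (hud : ∀ᵐ ν ∂μ, IsUniformlyDiscrete r ν) :
    (firstMoment (palmMeasure μ)).HasTemperateGrowth := by
  obtain ⟨C, hC, h⟩ := exists_firstMoment_ball_le hr hud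
  obtain ⟨K, hK, hK'⟩ := exists_lintegral_polyWeight_le (d := d) (half_pos hr) hC
  exact hasTemperateGrowth_of_lintegral_polyWeight
    (ne_top_of_le_ne_top hK (hK' _ (sFinite_firstMoment_palmMeasure hr hud) h))

/-- The pair Campbell formula as an identity of measures, so that it also applies to complex
integrands. -/
theorem comp_prod_kernel_eq (hst : IsStationaryLaw μ) (hr : 0 < r)
    (hud : ∀ᵐ ν ∂μ, IsUniformlyDiscrete r ν) :
    (kernel d ×ₖ kernel d) ∘ₘ μ = ((firstMoment (palmMeasure μ)).prod volume).map
      (fun p => (p.2, p.2 + p.1)) := by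
  have := sFinite_firstMoment_palmMeasure hr hud
  have hm : Measurable fun p : Space d × Space d => (p.2, p.2 + p.1) :=
    measurable_snd.prodMk (measurable_snd.add measurable_fst)
  refine Measure.ext_of_lintegral _ fun f hf => ?_
  rw [Measure.lintegral_bind (Kernel.aemeasurable _) hf.aemeasurable, lintegral_map hf hm,
    lintegral_prod (fun p : Space d × Space d => f (p.2, p.2 + p.1)) (hf.comp hm).aemeasurable]
  simp only [Kernel.prod_apply, kernel_apply]
  rw [← lintegral_lintegral_lintegral_eq hst (H := fun x y => f (x, y)) hf]
  exact lintegral_congr fun ν => lintegral_prod _ hf.aemeasurable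

theorem memLp_linearStatistic (hr : 0 < r) (hud : ∀ᵐ ν ∂μ, IsUniformlyDiscrete r ν)
    (φ : 𝓢(Space d, ℂ)) (p : ℝ≥0∞) : MemLp (linearStatistic φ) p μ := by
  obtain ⟨B, hB, h⟩ := φ.exists_lintegral_enorm_le (half_pos hr) ENNReal.one_ne_top
  refine MemLp.of_bound (stronglyMeasurable_linearStatistic φ).aestronglyMeasurable B.toReal
    (hud.mono fun ν hν => ?_)
  have := (enorm_integral_le_lintegral_enorm _).trans (h _ inferInstance hν.measure_ball_le)
  rw [← toReal_enorm]
  exact ENNReal.toReal_mono hB this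

/-- The second moment of a linear statistic in terms of the autocorrelation. -/
theorem integral_conj_linearStatistic_mul (hst : IsStationaryLaw μ) (hr : 0 < r)
    (hud : ∀ᵐ ν ∂μ, IsUniformlyDiscrete r ν) (φ : 𝓢(Space d, ℂ)) :
    ∫ ν, starRingEnd ℂ (linearStatistic φ ν) * linearStatistic φ ν ∂μ =
      ∫ z, ∫ x, starRingEnd ℂ (φ x) * φ (x + z) ∂volume ∂(firstMoment (palmMeasure μ)) := by
  have := sFinite_firstMoment_palmMeasure hr hud
  have hm : Measurable fun p : Space d × Space d => (p.2, p.2 + p.1) :=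
    measurable_snd.prodMk (measurable_snd.add measurable_fst)
  let Φ : Space d × Space d → ℂ := fun p => starRingEnd ℂ (φ p.1) * φ p.2
  have hΦ : Continuous Φ := (Complex.continuous_conj.comp (φ.continuous.comp continuous_fst)).mul
    (φ.continuous.comp continuous_snd)
  have hint : Integrable Φ ((kernel d ×ₖ kernel d) ∘ₘ μ) := by
    refine ⟨hΦ.aestronglyMeasurable, ?_⟩
    obtain ⟨B, hB, h⟩ := φ.exists_lintegral_enorm_le (half_pos hr) ENNReal.one_ne_top
    have hB2 : B * B < ∞ := (ENNReal.mul_ne_top hB hB).lt_top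
    refine lt_of_le_of_lt ?_ hB2
    rw [Measure.lintegral_bind (Kernel.aemeasurable _) hΦ.measurable.enorm.aemeasurable]
    calc _ ≤ ∫⁻ _, B * B ∂μ := by
          refine lintegral_mono_ae (hud.mono fun ν hν => ?_)
          rw [Kernel.prod_apply, kernel_apply]
          have e : ∀ p, ‖Φ p‖ₑ = ‖φ p.1‖ₑ * ‖φ p.2‖ₑ := fun p => by
            simp only [Φ, enorm_mul, RCLike.enorm_conj]
          simp_rw [e]
          rw [lintegral_prod_mul φ.continuous.measurable.enorm.aemeasurable
            φ.continuous.measurable.enorm.aemeasurable]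
          have := h _ inferInstance hν.measure_ball_le
          gcongr
      _ = B * B := by simp
  have hL : ∫ p, Φ p ∂((kernel d ×ₖ kernel d) ∘ₘ μ) =
      ∫ ν, starRingEnd ℂ (linearStatistic φ ν) * linearStatistic φ ν ∂μ := by
    have hint' := hint
    rw [Measure.comp_eq_comp_const_apply] at hint' ⊢
    rw [Kernel.integral_comp hint', Kernel.const_apply]
    refine integral_congr_ae (ae_of_all _ fun ν => ?_)
    simp only [Kernel.prod_apply, kernel_apply, Φ]
    rw [integral_prod_mul (fun x => starRingEnd ℂ (φ x)) φ, integral_conj]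
    rfl
  rw [← hL]
  rw [comp_prod_kernel_eq hst hr hud] at hint ⊢
  rw [integral_map hm.aemeasurable hΦ.aestronglyMeasurable]
  exact integral_prod _ (hint.comp_measurable hm)

/-- The squared modulus of a Schwartz function, as a Schwartz function. -/
noncomputable def SchwartzMap.normSq (f : 𝓢(Space d, ℂ)) : 𝓢(Space d, ℂ) :=
  SchwartzMap.pairing (ContinuousLinearMap.mul ℂ ℂ)
    (SchwartzMap.postcompCLM (𝕜 := ℝ) (Complex.conjCLE : ℂ →L[ℝ] ℂ) f) f

theorem SchwartzMap.normSq_apply (f : 𝓢(Space d, ℂ)) (x : Space d) :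
    f.normSq x = starRingEnd ℂ (f x) * f x := by
  rw [normSq, SchwartzMap.pairing_apply_apply]
  rfl

/-- Shifting the transform by z is modulating f, so Plancherel leaves ∫ e^{-2πi ξ·z} |f(ξ)|² dξ. -/
theorem fourier_normSq (f : 𝓢(Space d, ℂ)) (z : Space d) :
    ∫ x, starRingEnd ℂ (𝓕 f x) * 𝓕 f (x + z) = 𝓕 f.normSq z := by
  simp_rw [← fourier_modulate_apply]
  have := SchwartzMap.integral_inner_fourier_fourier f (modulate z f)
  simp only [RCLike.inner_apply] at this
  simp_rw [mul_comm (starRingEnd ℂ _), this]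
  rw [SchwartzMap.fourier_coe, Real.fourier_eq]
  refine integral_congr_ae (ae_of_all _ fun ξ => ?_)
  simp only [modulate_apply, SchwartzMap.normSq_apply, Circle.smul_def, smul_eq_mul]
  ring

/-- The isometry between linear statistics and the Fourier transform of the autocorrelation. -/
theorem eLpNorm_linearStatistic_fourier (hst : IsStationaryLaw μ) (hr : 0 < r)
    (hud : ∀ᵐ ν ∂μ, IsUniformlyDiscrete r ν) {σ : Measure (Space d)}
    (hσ : IsFourierTransform (firstMoment (palmMeasure μ)) σ) (f : 𝓢(Space d, ℂ)) :
    eLpNorm (linearStatistic (𝓕 f)) 2 μ = eLpNorm f 2 σ := by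
  have := hσ.temperate_right
  have hi := integral_conj_linearStatistic_mul hst hr hud (𝓕 f)
  simp_rw [fourier_normSq] at hi
  rw [← hσ.integral_eq] at hi
  simp_rw [SchwartzMap.normSq_apply, ← Complex.normSq_eq_conj_mul_self, Complex.normSq_eq_norm_sq]
    at hi
  rw [integral_complex_ofReal, integral_complex_ofReal, Complex.ofReal_inj] at hi
  have h1 := memLp_linearStatistic hr hud (𝓕 f) 2
  have h2 := f.memLp 2 σ
  rw [MemLp.eLpNorm_eq_integral_rpow_norm two_ne_zero ENNReal.ofNat_ne_top h1,
    MemLp.eLpNorm_eq_integral_rpow_norm two_ne_zero ENNReal.ofNat_ne_top h2]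
  simp [hi]

end LinearStatistics

/-! ### A Bochner–Schwartz theorem: uniqueness and existence of σ. -/

section Bochner

open Filter Topology
open scoped ComplexOrder

variable {d : ℕ}

theorem integral_withDensity_ofReal {ρ : Measure (Space d)} {h : Space d → ℝ} (hm : Measurable h)
    (h0 : ∀ x, 0 ≤ h x) (f : Space d → ℂ) :
    ∫ x, f x ∂(ρ.withDensity fun x => ENNReal.ofReal (h x)) = ∫ x, (h x : ℂ) * f x ∂ρ := by
  rw [integral_withDensity_eq_integral_toReal_smul hm.ennreal_ofReal
    (ae_of_all _ fun _ => ENNReal.ofReal_lt_top)]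
  refine integral_congr_ae (ae_of_all _ fun x => ?_)
  simp [ENNReal.toReal_ofReal (h0 x)]

theorem withDensity_ofReal_inv {ρ : Measure (Space d)} {h : Space d → ℝ} (hm : Measurable h)
    (h0 : ∀ x, 0 < h x) :
    (ρ.withDensity fun x => ENNReal.ofReal (h x)).withDensity
      (fun x => (ENNReal.ofReal (h x))⁻¹) = ρ :=
  withDensity_inv_same hm.ennreal_ofReal
    (ae_of_all _ fun x => (ENNReal.ofReal_pos.2 (h0 x)).ne')
    (ae_of_all _ fun _ => ENNReal.ofReal_ne_top)

theorem isFiniteMeasure_withDensity_gaussian {σ : Measure (Space d)} (hσ : σ.HasTemperateGrowth) :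
    IsFiniteMeasure (σ.withDensity fun x => ENNReal.ofReal (Real.exp (-1 * ‖x‖ ^ 2))) := by
  refine isFiniteMeasure_withDensity ?_
  have := (gaussianReal (d := d) 1 one_pos).integrable (μ := σ) |>.hasFiniteIntegral
  exact ((hasFiniteIntegral_iff_ofReal (ae_of_all _ fun x => (Real.exp_pos _).le)).1 this).ne

/-- A positive measure is determined by its integrals against Schwartz functions. -/
theorem measure_eq_of_integral_schwartz_eq {σ τ : Measure (Space d)} (hσ : σ.HasTemperateGrowth)
    (hτ : τ.HasTemperateGrowth) (h : ∀ f : 𝓢(Space d, ℂ), ∫ x, f x ∂σ = ∫ x, f x ∂τ) :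
    σ = τ := by
  have hg : Measurable fun x : Space d => Real.exp (-1 * ‖x‖ ^ 2) := by fun_prop
  have h1 := isFiniteMeasure_withDensity_gaussian hσ
  have h2 := isFiniteMeasure_withDensity_gaussian hτ
  -- Gaussian weighting makes a temperate measure finite, and its characteristic function is then an
  -- integral against a modulated Gaussian. The factor −1/(2π) converts e^{i x·t} to the convention
  -- e^{-2πi x·t}.
  have hc : ∀ (ρ : Measure (Space d)) (t : Space d),
      charFun (ρ.withDensity fun x => ENNReal.ofReal (Real.exp (-1 * ‖x‖ ^ 2))) t =
        ∫ x, modulate (-(2 * Real.pi)⁻¹ • t) (gaussian 1 one_pos) x ∂ρ := by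
    intro ρ t
    rw [charFun_apply, integral_withDensity_ofReal hg fun x => (Real.exp_pos _).le]
    refine integral_congr_ae (ae_of_all _ fun x => ?_)
    simp only [modulate_apply, gaussian_apply, Real.fourierChar_apply, inner_smul_right]
    rw [mul_comm]
    congr 3
    push_cast
    field_simp [Real.pi_ne_zero]
  have := Measure.ext_of_charFun (funext fun t => by rw [hc σ t, hc τ t, h] :
    charFun (σ.withDensity fun x => ENNReal.ofReal (Real.exp (-1 * ‖x‖ ^ 2))) =
      charFun (τ.withDensity fun x => ENNReal.ofReal (Real.exp (-1 * ‖x‖ ^ 2))))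
  rw [← withDensity_ofReal_inv (ρ := σ) hg fun x => Real.exp_pos _, this,
    withDensity_ofReal_inv hg fun x => Real.exp_pos _]

theorem norm_fourier_compSubConstCLM (a : Space d) (f : 𝓢(Space d, ℂ)) (z : Space d) :
    ‖𝓕 (SchwartzMap.compSubConstCLM ℂ a f) z‖ = ‖𝓕 f z‖ := by
  have : 𝓕 (SchwartzMap.compSubConstCLM ℂ a f) z = Real.fourierChar (-inner ℝ a z) * 𝓕 f z := by
    rw [SchwartzMap.fourier_coe, SchwartzMap.fourier_coe, Real.fourier_eq, Real.fourier_eq,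
      ← integral_add_right_eq_self _ a, ← integral_const_mul]
    refine integral_congr_ae (ae_of_all _ fun v => ?_)
    have e : Real.fourierChar (-inner ℝ (v + a) z) =
        Real.fourierChar (-inner ℝ a z) * Real.fourierChar (-inner ℝ v z) := by
      rw [inner_add_left, neg_add_rev, AddChar.map_add_eq_mul]
    simp only [SchwartzMap.compSubConstCLM_apply, add_sub_cancel_right, e, Circle.smul_def,
      Circle.coe_mul, smul_eq_mul, mul_assoc]
  rw [this, norm_mul, Circle.norm_coe, one_mul]

theorem norm_modulate_apply (k : Space d) (f : 𝓢(Space d, ℂ)) (x : Space d) :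
    ‖modulate k f x‖ = ‖f x‖ := by
  rw [modulate_apply, norm_mul, Circle.norm_coe, one_mul]

variable {ω : Measure (Space d)}

theorem continuous_uncurry_modulate (g : 𝓢(Space d, ℂ)) :
    Continuous fun p : Space d × Space d => modulate p.1 g p.2 := by
  simp_rw [modulate_apply]
  have := g.continuous
  fun_prop

/-- By Fubini, k ↦ ∫ `modulate k g` dω is the density of the Fourier transform of the measure g·ω.
-/
theorem integral_mul_integral_modulate [SFinite ω] [ω.HasTemperateGrowth]
    (f g : 𝓢(Space d, ℂ)) :
    ∫ k, f k * ∫ z, modulate k g z ∂ω = ∫ z, g z * 𝓕 f z ∂ω := by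
  have hint : Integrable (fun p : Space d × Space d => f p.1 * modulate p.1 g p.2)
      (volume.prod ω) := by
    refine (f.integrable.mul_prod (g.integrable (μ := ω))).mono
      ((f.continuous.comp continuous_fst).mul
        (continuous_uncurry_modulate g)).aestronglyMeasurable (ae_of_all _ fun p => ?_)
    simp [norm_modulate_apply]
  simp_rw [← integral_const_mul]
  rw [integral_integral_swap hint]
  refine integral_congr_ae (ae_of_all _ fun z => ?_)
  simp only [SchwartzMap.fourier_coe, Real.fourier_eq]
  rw [← integral_const_mul]
  refine integral_congr_ae (ae_of_all _ fun k => ?_)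
  simp only [modulate_apply, Circle.smul_def, smul_eq_mul, real_inner_comm k z]
  ring

theorem tendsto_integral_gaussian_mul [ω.HasTemperateGrowth] (f : 𝓢(Space d, ℂ)) :
    Tendsto (fun n : ℕ => ∫ z, gaussian (1 / ((n : ℝ) + 1)) Nat.one_div_pos_of_nat z * f z ∂ω)
      atTop (𝓝 (∫ z, f z ∂ω)) := by
  refine tendsto_integral_of_dominated_convergence (fun z => ‖f z‖)
    (fun n => ((SchwartzMap.continuous _).mul f.continuous).aestronglyMeasurable)
    (f.integrable (μ := ω)).norm (fun n => ae_of_all _ fun z => ?_) (ae_of_all _ fun z => ?_)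
  · rw [norm_mul, norm_gaussian_apply]
    refine mul_le_of_le_one_left (norm_nonneg _) (Real.exp_le_one_iff.2 ?_)
    have : (0 : ℝ) < 1 / ((n : ℝ) + 1) := Nat.one_div_pos_of_nat
    nlinarith [sq_nonneg ‖z‖]
  · have h1 : Tendsto (fun n : ℕ => -(1 / ((n : ℝ) + 1)) * ‖z‖ ^ 2) atTop (𝓝 (-0 * ‖z‖ ^ 2)) :=
      (tendsto_one_div_add_atTop_nhds_zero_nat.neg).mul_const _
    have h2 := (Complex.continuous_ofReal.tendsto _).comp ((Real.continuous_exp.tendsto _).comp h1)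
    have := h2.mul_const (f z)
    simpa [gaussian_apply] using this

/-- If the translation-bounded densities `∫ g_k dω` of a temperate measure `ω` against modulated
Gaussians are nonnegative, then `ω` has a positive Fourier transform. -/
theorem exists_isFourierTransform_of_modulate_gaussian_nonneg [SFinite ω]
    (hω : ω.HasTemperateGrowth)
    (hpos : ∀ (b : ℝ) (hb : 0 < b) (k : Space d), 0 ≤ ∫ z, modulate k (gaussian b hb) z ∂ω) :
    ∃ σ, IsFourierTransform ω σ := by
  let g : ℕ → 𝓢(Space d, ℂ) := fun n => gaussian (1 / ((n : ℝ) + 1)) Nat.one_div_pos_of_nat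
  let S : ℕ → Space d → ℝ := fun n k => (∫ z, modulate k (g n) z ∂ω).re
  have hS0 : ∀ n k, 0 ≤ S n k := fun n k => (Complex.nonneg_iff.1 (hpos _ _ k)).1
  have hS : ∀ n k, (S n k : ℂ) = ∫ z, modulate k (g n) z ∂ω := fun n k =>
    Complex.ext rfl (Complex.nonneg_iff.1 (hpos _ Nat.one_div_pos_of_nat k)).2
  have hSm : ∀ n, Measurable (S n) := fun n =>
    Complex.measurable_re.comp (StronglyMeasurable.integral_prod_right'
      (continuous_uncurry_modulate (g n)).stronglyMeasurable).measurable
  let σ : ℕ → Measure (Space d) := fun n => volume.withDensity fun k => ENNReal.ofReal (S n k)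
  have hσf : ∀ n (f : 𝓢(Space d, ℂ)), ∫ k, f k ∂(σ n) = ∫ z, g n z * 𝓕 f z ∂ω := by
    intro n f
    rw [integral_withDensity_ofReal (hSm n) (hS0 n), ← integral_mul_integral_modulate]
    simp_rw [hS, mul_comm]
  have hg1 : ∀ n z, ‖g n z‖ ≤ 1 := by
    intro n z
    have : (0 : ℝ) < 1 / ((n : ℝ) + 1) := Nat.one_div_pos_of_nat
    rw [norm_gaussian_apply]
    exact Real.exp_le_one_iff.2 (by nlinarith [sq_nonneg ‖z‖])
  -- uniform bound on unit balls
  let C : ℝ≥0∞ := ENNReal.ofReal (Real.exp 1 * ∫ z, ‖𝓕 (gaussian (d := d) 1 one_pos) z‖ ∂ω)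
  have hball : ∀ n a, σ n (Metric.ball a 1) ≤ C := by
    intro n a
    let G : 𝓢(Space d, ℂ) := SchwartzMap.compSubConstCLM ℂ a (gaussian 1 one_pos)
    have hG : ∀ x, G x = (Real.exp (-1 * ‖x - a‖ ^ 2) : ℝ) := fun x => rfl
    -- The factor e makes this Gaussian at least 1 on the unit ball about a.
    let E : Space d → ℝ := fun x => Real.exp 1 * Real.exp (-1 * ‖x - a‖ ^ 2)
    have hE0 : ∀ x, 0 ≤ E x := fun x => by positivity
    have hEm : Measurable E := by fun_prop
    have hEG : ∀ x, (E x : ℂ) = Real.exp 1 * G x := fun x => by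
      rw [hG, ← Complex.ofReal_mul]
    have hEi : Integrable E := by
      have h := (G.integrable (μ := volume)).re.const_mul (Real.exp 1)
      exact h
    have hSE : Integrable fun x => S n x * E x := by
      refine hEi.bdd_mul (c := ∫ z, ‖g n z‖ ∂ω) (hSm n).aestronglyMeasurable
        (ae_of_all _ fun k => ?_)
      refine (Complex.abs_re_le_norm _).trans ((norm_integral_le_integral_norm _).trans_eq ?_)
      simp_rw [norm_modulate_apply]
    -- On the Fourier side the centre a contributes only a phase and |g_n| ≤ 1, so the bound depends
    -- on neither n nor a.
    have hre : ∫ x, S n x * E x ≤ Real.exp 1 * ∫ z, ‖𝓕 (gaussian (d := d) 1 one_pos) z‖ ∂ω := by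
      have h1 : ((∫ x, S n x * E x : ℝ) : ℂ) = Real.exp 1 * ∫ z, g n z * 𝓕 G z ∂ω := by
        rw [← hσf, integral_withDensity_ofReal (hSm n) (hS0 n), ← integral_const_mul,
          ← integral_complex_ofReal]
        refine integral_congr_ae (ae_of_all _ fun x => ?_)
        simp only [Complex.ofReal_mul, hEG]
        ring
      calc ∫ x, S n x * E x ≤ ‖((∫ x, S n x * E x : ℝ) : ℂ)‖ := by
            rw [Complex.norm_real]; exact le_abs_self _
        _ ≤ Real.exp 1 * ∫ z, ‖𝓕 (gaussian (d := d) 1 one_pos) z‖ ∂ω := by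
            rw [h1, norm_mul, Complex.norm_real, Real.norm_of_nonneg (Real.exp_pos 1).le]
            gcongr
            refine norm_integral_le_of_norm_le ((𝓕 (gaussian (d := d) 1 one_pos)).integrable
              (μ := ω)).norm (ae_of_all _ fun z => ?_)
            rw [norm_mul, norm_fourier_compSubConstCLM]
            exact mul_le_of_le_one_left (norm_nonneg _) (hg1 n z)
    calc σ n (Metric.ball a 1) = ∫⁻ x, (Metric.ball a 1).indicator 1 x ∂(σ n) :=
          (lintegral_indicator_one Metric.isOpen_ball.measurableSet).symm
      _ ≤ ∫⁻ x, ENNReal.ofReal (E x) ∂(σ n) := by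
          refine lintegral_mono (indicator_le fun x hx => ?_)
          rw [Pi.one_apply, ENNReal.one_le_ofReal]
          rw [mem_ball_iff_norm] at hx
          simp only [E]
          rw [← Real.exp_add, Real.one_le_exp_iff]
          nlinarith [norm_nonneg (x - a)]
      _ = ∫⁻ x, ENNReal.ofReal (S n x * E x) := by
          rw [lintegral_withDensity_eq_lintegral_mul _ (hSm n).ennreal_ofReal hEm.ennreal_ofReal]
          simp_rw [Pi.mul_apply, ENNReal.ofReal_mul (hS0 n _)]
      _ = ENNReal.ofReal (∫ x, S n x * E x) :=
          (ofReal_integral_eq_lintegral_ofReal hSE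
            (ae_of_all _ fun x => mul_nonneg (hS0 n x) (hE0 x))).symm
      _ ≤ C := ENNReal.ofReal_le_ofReal hre
  have hCtop : C ≠ ∞ := ENNReal.ofReal_ne_top
  obtain ⟨K, hK, hKle⟩ := exists_lintegral_polyWeight_le (d := d) one_pos hCtop
  obtain ⟨u, hu, hu0, hule⟩ := exists_setLIntegral_polyWeight_le (d := d) one_pos hCtop
  have hWm : Measurable (polyWeight d) := continuous_polyWeight.measurable
  -- The measures σ_n need not be finite. Weighted by `polyWeight d` they have a common mass bound
  -- and common tail bounds, so they lie in a compact set of finite measures.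
  let P : ℕ → FiniteMeasure (Space d) := fun n =>
    ⟨(σ n).withDensity fun x => ENNReal.ofReal (polyWeight d x),
      isFiniteMeasure_withDensity (ne_top_of_le_ne_top hK (hKle _ inferInstance (hball n)))⟩
  have hPc : ∀ n, P n ∈ {Q : FiniteMeasure (Space d) | Q.mass ≤ K.toNNReal ∧
      ∀ m : ℕ, Q (Metric.closedBall 0 (m : ℝ))ᶜ ≤ (u m).toNNReal} := by
    intro n
    refine ⟨?_, fun m => ?_⟩
    · rw [← ENNReal.coe_le_coe, FiniteMeasure.ennreal_mass, ENNReal.coe_toNNReal hK]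
      refine (withDensity_apply _ MeasurableSet.univ).trans_le ?_
      rw [Measure.restrict_univ]
      exact hKle _ inferInstance (hball n)
    · rw [← ENNReal.coe_le_coe, FiniteMeasure.ennreal_coeFn_eq_coeFn_toMeasure,
        ENNReal.coe_toNNReal (hu m)]
      exact (withDensity_apply _ Metric.isClosed_closedBall.measurableSet.compl).trans_le
        (hule _ inferInstance (hball n) m)
  have hcomp := isCompact_setOfPred_finiteMeasure_mass_le_compl_isCompact_le (E := Space d)
    (u := fun m => (u m).toNNReal) (K := fun m : ℕ => Metric.closedBall 0 (m : ℝ)) K.toNNReal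
    (by simpa [Function.comp_def] using (ENNReal.tendsto_toNNReal ENNReal.zero_ne_top).comp hu0)
    (fun m => isCompact_closedBall _ _) (Or.inl inferInstance)
  -- A limit along a free ultrafilter replaces the choice of a convergent subsequence; σ is this
  -- limit with the weight divided out.
  obtain ⟨Q, -, hQ⟩ := hcomp.ultrafilter_le_nhds (Ultrafilter.map P (hyperfilter ℕ))
    (le_principal_iff.2 (Filter.mem_map.2 (Filter.Eventually.of_forall hPc)))
  have hPQ : Tendsto P (hyperfilter ℕ) (𝓝 Q) := hQ
  rw [FiniteMeasure.tendsto_iff_forall_integral_rclike_tendsto ℂ] at hPQ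
  have hWi : Measurable fun x : Space d => (polyWeight d x)⁻¹ := hWm.inv
  have hWi0 : ∀ x : Space d, 0 ≤ (polyWeight d x)⁻¹ := fun x => (inv_pos.2 (polyWeight_pos x)).le
  refine ⟨(Q : Measure (Space d)).withDensity fun x => ENNReal.ofReal (polyWeight d x)⁻¹, hω,
    hasTemperateGrowth_of_lintegral_polyWeight ?_, fun f => ?_⟩
  · rw [lintegral_withDensity_eq_lintegral_mul _ hWi.ennreal_ofReal hWm.ennreal_ofReal]
    have : ∀ x : Space d, ((fun x => ENNReal.ofReal (polyWeight d x)⁻¹) * fun x =>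
        ENNReal.ofReal (polyWeight d x)) x = 1 := fun x => by
      rw [Pi.mul_apply, ← ENNReal.ofReal_mul (hWi0 x), inv_mul_cancel₀ (polyWeight_pos x).ne',
        ENNReal.ofReal_one]
    simp_rw [this]
    simp
  · obtain ⟨M, hM, hfM⟩ := f.exists_norm_le_polyWeight
    -- Dividing by the weight turns the Schwartz function f into a bounded continuous test function
    -- for the weak limit.
    let h : BoundedContinuousFunction (Space d) ℂ := BoundedContinuousFunction.ofNormedAddCommGroup
      (fun x => ((polyWeight d x)⁻¹ : ℝ) * f x)
      ((Complex.continuous_ofReal.comp (continuous_polyWeight.inv₀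
        fun x => (polyWeight_pos x).ne')).mul f.continuous) M (fun x => by
          rw [norm_mul, Complex.norm_real, Real.norm_of_nonneg (hWi0 x),
            inv_mul_le_iff₀ (polyWeight_pos x), mul_comm]
          exact hfM x)
    have h1 := hPQ h
    have h2 : ∀ n, ∫ x, h x ∂(P n : Measure (Space d)) = ∫ z, g n z * 𝓕 f z ∂ω := by
      intro n
      rw [← hσf]
      refine (integral_withDensity_ofReal hWm (fun x => (polyWeight_pos x).le) _).trans ?_
      refine integral_congr_ae (ae_of_all _ fun x => ?_)
      have := (polyWeight_pos x).ne'
      simp only [h, BoundedContinuousFunction.coe_ofNormedAddCommGroup, Complex.ofReal_inv]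
      field_simp
    simp_rw [h2] at h1
    have h3 := (tendsto_integral_gaussian_mul (ω := ω) (𝓕 f)).mono_left
      (Nat.hyperfilter_le_atTop)
    rw [integral_withDensity_ofReal hWi hWi0]
    exact tendsto_nhds_unique h1 h3

theorem existsUnique_isFourierTransform_of_modulate_gaussian_nonneg [SFinite ω]
    (hω : ω.HasTemperateGrowth)
    (hpos : ∀ (b : ℝ) (hb : 0 < b) (k : Space d), 0 ≤ ∫ z, modulate k (gaussian b hb) z ∂ω) :
    ∃! σ, IsFourierTransform ω σ := by
  obtain ⟨σ, hσ⟩ := exists_isFourierTransform_of_modulate_gaussian_nonneg hω hpos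
  exact ⟨σ, hσ, fun τ hτ => measure_eq_of_integral_schwartz_eq hτ.temperate_right
    hσ.temperate_right fun f => by rw [hτ.integral_eq, hσ.integral_eq]⟩

end Bochner

/-! ### Positivity of the autocorrelation and existence of its transform. -/

section Existence

open PointMeasure ProbabilityTheory
open scoped ComplexOrder

variable {d : ℕ} {μ : Measure (PointMeasure d)} [IsProbabilityMeasure μ] {r : ℝ}

/-- Completing the square, 2b‖x‖² + 2b‖x + z‖² = 4b‖x + z/2‖² + b‖z‖², while the two phases combine
to the one at z. So the modulated Gaussian of parameter b is a multiple of the autocorrelation of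
the one of parameter 2b. -/
theorem integral_conj_modulate_gaussian_mul {b : ℝ} (hb : 0 < b) (k z : Space d) :
    ∫ x, starRingEnd ℂ (modulate k (gaussian (2 * b) (by positivity)) x) *
        modulate k (gaussian (2 * b) (by positivity)) (x + z) =
      ((∫ x : Space d, Real.exp (-(4 * b) * ‖x‖ ^ 2) : ℝ) : ℂ) * modulate k (gaussian b hb) z := by
  have h : ∀ x : Space d, starRingEnd ℂ (modulate k (gaussian (2 * b) (by positivity)) x) *
      modulate k (gaussian (2 * b) (by positivity)) (x + z) =
      (Real.exp (-(4 * b) * ‖x + (2⁻¹ : ℝ) • z‖ ^ 2) : ℝ) * modulate k (gaussian b hb) z := by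
    intro x
    have hn : -(2 * b) * ‖x‖ ^ 2 + -(2 * b) * ‖x + z‖ ^ 2 =
        -(4 * b) * ‖x + (2⁻¹ : ℝ) • z‖ ^ 2 + -b * ‖z‖ ^ 2 := by
      rw [norm_add_sq_real, norm_add_sq_real, inner_smul_right, norm_smul]
      norm_num
      ring
    have he : starRingEnd ℂ (Real.fourierChar (-inner ℝ x k) : ℂ) *
        Real.fourierChar (-inner ℝ (x + z) k) = Real.fourierChar (-inner ℝ z k) := by
      rw [inner_add_left, neg_add, AddChar.map_add_eq_mul, Circle.coe_mul, ← mul_assoc,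
        ← Complex.normSq_eq_conj_mul_self]
      simp
    simp only [modulate_apply, gaussian_apply, map_mul, Complex.conj_ofReal]
    rw [mul_mul_mul_comm, he, ← Complex.ofReal_mul, ← Real.exp_add, hn, Real.exp_add,
      Complex.ofReal_mul]
    ring
  simp_rw [h]
  rw [integral_mul_const, integral_complex_ofReal,
    integral_add_right_eq_self (fun x : Space d => Real.exp (-(4 * b) * ‖x‖ ^ 2))]

/-- Up to a positive factor the integral is the second moment of a linear statistic. -/
theorem integral_modulate_gaussian_nonneg (hst : IsStationaryLaw μ) (hr : 0 < r)
    (hud : ∀ᵐ ν ∂μ, IsUniformlyDiscrete r ν) (b : ℝ) (hb : 0 < b) (k : Space d) :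
    0 ≤ ∫ z, modulate k (gaussian b hb) z ∂(firstMoment (palmMeasure μ)) := by
  have h := integral_conj_linearStatistic_mul hst hr hud
    (modulate k (gaussian (2 * b) (by positivity)))
  simp_rw [integral_conj_modulate_gaussian_mul hb, ← Complex.normSq_eq_conj_mul_self] at h
  rw [integral_const_mul, integral_complex_ofReal] at h
  have hc : 0 < ∫ x : Space d, Real.exp (-(4 * b) * ‖x‖ ^ 2) := by
    rw [GaussianFourier.integral_rexp_neg_mul_sq_norm (by positivity)]
    positivity
  have h2 : (0 : ℂ) ≤ ((∫ ν, Complex.normSq (linearStatistic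
      (modulate k (gaussian (2 * b) (by positivity))) ν) ∂μ : ℝ) : ℂ) :=
    Complex.zero_le_real.2 (integral_nonneg fun ν => Complex.normSq_nonneg _)
  rw [h] at h2
  have h3 := mul_nonneg (Complex.zero_le_real.2 (inv_pos.2 hc).le) h2
  rwa [← mul_assoc, ← Complex.ofReal_mul, inv_mul_cancel₀ hc.ne', Complex.ofReal_one,
    one_mul] at h3

theorem existsUnique_isFourierTransform_autocorrelation (hst : IsStationaryLaw μ) (hr : 0 < r)
    (hud : ∀ᵐ ν ∂μ, IsUniformlyDiscrete r ν) :
    ∃! σ, IsFourierTransform (firstMoment (palmMeasure μ)) σ := by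
  have := sFinite_firstMoment_palmMeasure hr hud
  exact existsUnique_isFourierTransform_of_modulate_gaussian_nonneg
    (hasTemperateGrowth_firstMoment_palmMeasure hr hud)
    (integral_modulate_gaussian_nonneg hst hr hud)

end Existence

/-! ### Almost surely invariant functions are constant. -/

section Ergodicity

open PointMeasure ProbabilityTheory

variable {d : ℕ} {μ : Measure (PointMeasure d)} [IsProbabilityMeasure μ]

/-- A measurable function that is almost surely invariant under each translation is almost surely
constant. -/
theorem IsErgodicLaw.exists_ae_eq_const (he : IsErgodicLaw μ) {g : PointMeasure d → ℝ}
    (hg : Measurable g) (hinv : ∀ t : Space d, ∀ᵐ ν ∂μ, g (translate t ν) = g ν) :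
    ∃ M : ℝ, ∀ᵐ ν ∂μ, g ν = M := by
  have hm : Measurable fun p : PointMeasure d × Space d => g (translate p.2 p.1) :=
    hg.comp (measurable_translate.comp measurable_swap)
  have hae : ∀ᵐ ν ∂μ, ∀ᵐ s : Space d, g (translate s ν) = g ν := by
    refine (Measure.ae_ae_comm (μ := μ) (ν := (volume : Measure (Space d)))
      (p := fun ν s => g (translate s ν) = g ν) ?_).2 (ae_of_all _ hinv)
    exact measurableSet_eq_fun hm (hg.comp measurable_fst)
  have key : ∀ U : Set ℝ, MeasurableSet U → (∀ᵐ ν ∂μ, g ν ∈ U) ∨ (∀ᵐ ν ∂μ, g ν ∉ U) := by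
    intro U hU
    -- Ergodicity is assumed only for strictly invariant sets. Asking that g ∘ T_s lie in U for
    -- Lebesgue-almost every s gives a strictly invariant set, which by Fubini agrees almost surely
    -- with {g ∈ U}.
    let D : Set (PointMeasure d) := {ν | ∀ᵐ s : Space d, g (translate s ν) ∈ U}
    have hDm : MeasurableSet D := by
      have h0 : D = {ν | volume (Prod.mk ν ⁻¹'
          {p : PointMeasure d × Space d | g (translate p.2 p.1) ∉ U}) = 0} := by
        ext ν
        simp only [D, mem_ofPred_eq, ae_iff]
        rfl
      rw [h0]
      exact measurable_measure_prodMk_left (hm hU).compl (measurableSet_singleton 0)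
    have hDinv : ∀ t : Space d, PointMeasure.translate t ⁻¹' D = D := by
      intro t
      ext ν
      simp only [D, mem_preimage, mem_ofPred_eq, PointMeasure.translate_translate]
      have := eventually_add_right_iff (volume : Measure (Space d)) t
        (p := fun s => g (translate s ν) ∈ U)
      exact this
    have hDU : ∀ᵐ ν ∂μ, (ν ∈ D ↔ g ν ∈ U) := by
      filter_upwards [hae] with ν hν
      constructor
      · intro h
        obtain ⟨s, h1, h2⟩ := (hν.and h).exists
        rwa [← h1]
      · intro h
        filter_upwards [hν] with s hs
        rwa [hs]
    rcases he D hDm hDinv with h | h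
    · right
      filter_upwards [hDU, measure_eq_zero_iff_ae_notMem.1 h] with ν h1 h2
      rwa [← h1]
    · left
      filter_upwards [hDU, measure_eq_zero_iff_ae_notMem.1 h] with ν h1 h2
      rwa [← h1, ← not_notMem]
  exact Filter.exists_eventuallyEq_const_of_forall_separating MeasurableSet key

end Ergodicity

/-! ### Expected difference of a linear statistic and its translate. -/

section Difference

open PointMeasure ProbabilityTheory

variable {d : ℕ}

theorem IsUniformlyDiscrete.translate {r : ℝ} {ν : PointMeasure d} (h : IsUniformlyDiscrete r ν)
    (t : Space d) : IsUniformlyDiscrete r (PointMeasure.translate t ν) := by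
  intro a
  have hm : MeasurableSet ((fun x => a + x) '' cube d r) :=
    ((Homeomorph.addLeft a).isOpenMap _ (isOpen_cube d r)).measurableSet
  rw [toMeasure_translate, Measure.map_apply (measurable_const_add t) hm]
  convert h (-t + a) using 2
  ext x
  constructor
  · rintro ⟨y, hy, hxy⟩
    refine ⟨y, hy, ?_⟩
    simp only at hxy ⊢
    rw [add_assoc, hxy, neg_add_cancel_left]
  · rintro ⟨y, hy, rfl⟩
    exact ⟨y, hy, by simp [add_assoc]⟩

namespace PointMeasure

theorem measurable_measure_singleton (ν : PointMeasure d) :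
    Measurable fun x => ν.toMeasure {x} := by
  have h : ∀ x, ν.toMeasure {x} = ν.toMeasure (Prod.mk x ⁻¹' diagonal (Space d)) := fun x => by
    congr 1
    ext y
    simp [eq_comm]
  simp_rw [h]
  exact measurable_measure_prodMk_left measurableSet_diagonal

theorem measurableSet_points (ν : PointMeasure d) : MeasurableSet ν.points :=
  (ν.measurable_measure_singleton (measurableSet_singleton 0)).compl

/-- A point measure charges only its points. -/
theorem measure_compl_points (ν : PointMeasure d) : ν.toMeasure ν.pointsᶜ = 0 := by
  refine measure_null_of_locally_null _ fun x hx => ?_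
  have hx0 : ν.toMeasure {x} = 0 := by simpa [points] using hx
  -- The masses of balls shrinking to x tend to 0 and are integers, so some ball about x is null.
  have hlim := tendsto_measure_iInter_atTop (μ := ν.toMeasure)
    (s := fun n : ℕ => Metric.ball x (1 / ((n : ℝ) + 1)))
    (fun n => Metric.isOpen_ball.measurableSet.nullMeasurableSet)
    (fun m n hmn => Metric.ball_subset_ball (Nat.one_div_le_one_div hmn))
    ⟨0, ν.measure_ne_top Metric.isBounded_ball⟩
  have hI : ⋂ n : ℕ, Metric.ball x (1 / ((n : ℝ) + 1)) = {x} := by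
    refine Subset.antisymm (fun y hy => ?_) (singleton_subset_iff.2 (mem_iInter.2 fun n =>
      Metric.mem_ball_self Nat.one_div_pos_of_nat))
    refine mem_singleton_iff.2 (dist_le_zero.1 ?_)
    refine ge_of_tendsto' tendsto_one_div_add_atTop_nhds_zero_nat fun n => ?_
    exact (mem_iInter.1 hy n).le
  rw [hI, hx0] at hlim
  obtain ⟨n, hn⟩ := (hlim.eventually (gt_mem_nhds zero_lt_one)).exists
  refine ⟨Metric.ball x (1 / ((n : ℝ) + 1)),
    mem_nhdsWithin_of_mem_nhds (Metric.ball_mem_nhds x Nat.one_div_pos_of_nat), ?_⟩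
  obtain ⟨m, hm⟩ := ν.exists_nat' (Metric.ball x (1 / ((n : ℝ) + 1)))
    Metric.isOpen_ball.measurableSet Metric.isBounded_ball
  exact hm.trans (by
    rw [Function.comp_apply, hm] at hn
    have : m < 1 := by exact_mod_cast hn
    simpa using this)

end PointMeasure

theorem IsUniformlyDiscrete.measure_singleton {r : ℝ} (hr : 0 < r) {ν : PointMeasure d}
    (h : IsUniformlyDiscrete r ν) (x : Space d) :
    ν.toMeasure {x} = ν.points.indicator 1 x := by
  by_cases hx : x ∈ ν.points
  · rw [indicator_of_mem hx, Pi.one_apply]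
    refine le_antisymm ((measure_mono ?_).trans (h.measure_ball_le x)) ?_
    · exact singleton_subset_iff.2 (Metric.mem_ball_self (half_pos hr))
    · obtain ⟨n, hn⟩ := ν.exists_nat' {x} (measurableSet_singleton x)
        Bornology.isBounded_singleton
      rw [hn]
      have h0 : n ≠ 0 := by
        rintro rfl
        exact hx (by simpa using hn)
      exact_mod_cast Nat.one_le_iff_ne_zero.2 h0
  · rw [indicator_of_notMem hx]
    simpa [points] using hx

/-- The common part of two simple point measures. -/
theorem restrict_points_eq {r : ℝ} (hr : 0 < r) {ν ν' : PointMeasure d}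
    (h : IsUniformlyDiscrete r ν) (h' : IsUniformlyDiscrete r ν') :
    ν.toMeasure.restrict ν'.points = ν'.toMeasure.restrict ν.points := by
  classical
  ext A hA
  -- Both sides equal the ν × ν' mass of the diagonal over A, sliced in one coordinate or the other.
  have hS : MeasurableSet {p : Space d × Space d | p.1 = p.2 ∧ p.1 ∈ A} :=
    measurableSet_diagonal.inter (measurable_fst hA)
  have h1 := Measure.prod_apply (μ := ν.toMeasure) (ν := ν'.toMeasure) hS
  have h2 := Measure.prod_apply_symm (μ := ν.toMeasure) (ν := ν'.toMeasure) hS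
  rw [Measure.restrict_apply hA, Measure.restrict_apply hA,
    ← lintegral_indicator_one (hA.inter ν'.measurableSet_points),
    ← lintegral_indicator_one (hA.inter ν.measurableSet_points)]
  refine Eq.trans ?_ ((h1.symm.trans h2).trans ?_)
  · refine lintegral_congr fun x => ?_
    by_cases hx : x ∈ A
    · have : Prod.mk x ⁻¹' {p : Space d × Space d | p.1 = p.2 ∧ p.1 ∈ A} = {x} := by
        ext y; simp [hx, eq_comm]
      rw [this, h'.measure_singleton hr]
      simp [indicator_apply, hx]
    · have : Prod.mk x ⁻¹' {p : Space d × Space d | p.1 = p.2 ∧ p.1 ∈ A} = ∅ := by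
        ext y; simp [hx]
      rw [this]; simp [hx]
  · refine lintegral_congr fun x => ?_
    by_cases hx : x ∈ A
    · have : (fun y => (y, x)) ⁻¹' {p : Space d × Space d | p.1 = p.2 ∧ p.1 ∈ A} = {x} := by
        ext y
        simp only [mem_preimage, mem_ofPred_eq, mem_singleton_iff, and_iff_left_iff_imp]
        rintro rfl; exact hx
      rw [this, h.measure_singleton hr]
      simp [indicator_apply, hx]
    · have : (fun y => (y, x)) ⁻¹' {p : Space d × Space d | p.1 = p.2 ∧ p.1 ∈ A} = ∅ := by
        ext y
        simp only [mem_preimage, mem_ofPred_eq, mem_empty_iff_false, iff_false, not_and]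
        rintro rfl; exact hx
      rw [this]; simp [hx]

/-- The contributions of common points cancel in the difference, so twice their |φ|-mass can be
taken off the total. It is written additively because the values lie in [0, ∞]. -/
theorem enorm_integral_sub_add_le {r : ℝ} (hr : 0 < r) {ν ν' : PointMeasure d}
    (h : IsUniformlyDiscrete r ν) (h' : IsUniformlyDiscrete r ν') (φ : 𝓢(Space d, ℂ)) :
    ‖linearStatistic φ ν - linearStatistic φ ν'‖ₑ +
      (∫⁻ x in ν.points, ‖φ x‖ₑ ∂ν'.toMeasure + ∫⁻ x in ν.points, ‖φ x‖ₑ ∂ν'.toMeasure) ≤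
      ∫⁻ x, ‖φ x‖ₑ ∂ν.toMeasure + ∫⁻ x, ‖φ x‖ₑ ∂ν'.toMeasure := by
  have := h.hasTemperateGrowth hr
  have := h'.hasTemperateGrowth hr
  have hR := restrict_points_eq hr h h'
  have e1 : linearStatistic φ ν - linearStatistic φ ν' =
      ∫ x in ν'.pointsᶜ, φ x ∂ν.toMeasure - ∫ x in ν.pointsᶜ, φ x ∂ν'.toMeasure := by
    rw [linearStatistic, linearStatistic,
      ← integral_add_compl ν'.measurableSet_points (φ.integrable (μ := ν.toMeasure)),
      ← integral_add_compl ν.measurableSet_points (φ.integrable (μ := ν'.toMeasure)), hR]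
    ring
  have e2 : ‖linearStatistic φ ν - linearStatistic φ ν'‖ₑ ≤
      ∫⁻ x in ν'.pointsᶜ, ‖φ x‖ₑ ∂ν.toMeasure + ∫⁻ x in ν.pointsᶜ, ‖φ x‖ₑ ∂ν'.toMeasure := by
    rw [e1]
    exact enorm_sub_le.trans (add_le_add (enorm_integral_le_lintegral_enorm _)
      (enorm_integral_le_lintegral_enorm _))
  rw [← lintegral_add_compl _ ν'.measurableSet_points (μ := ν.toMeasure),
    ← lintegral_add_compl _ ν.measurableSet_points (μ := ν'.toMeasure), hR]
  refine (add_le_add_left e2 _).trans_eq ?_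
  ring

variable {μ : Measure (PointMeasure d)} [IsProbabilityMeasure μ] {r : ℝ}

/-- The pair formula for h(x) 1_{y = x + s}: the atom of ω at s is the density of points x, with
multiplicity, for which x + s is also a point. -/
theorem lintegral_mul_measure_singleton_add (hst : IsStationaryLaw μ) {h : Space d → ℝ≥0∞}
    (hm : Measurable h) (s : Space d) :
    ∫⁻ ν, ∫⁻ x, h x * ν.toMeasure {x + s} ∂ν.toMeasure ∂μ =
      firstMoment (palmMeasure μ) {s} * ∫⁻ x, h x := by
  classical
  have hS : MeasurableSet {p : Space d × Space d | p.2 = p.1 + s} :=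
    measurableSet_eq_fun measurable_snd (measurable_fst.add_const s)
  have hH : Measurable fun p : Space d × Space d =>
      h p.1 * ({p : Space d × Space d | p.2 = p.1 + s}).indicator (1 : Space d × Space d → ℝ≥0∞) p :=
    (hm.comp measurable_fst).mul (measurable_one.indicator hS)
  have key := lintegral_lintegral_lintegral_eq hst (H := fun x y => h x *
    ({p : Space d × Space d | p.2 = p.1 + s}).indicator (1 : Space d × Space d → ℝ≥0∞) (x, y)) hH
  have e1 : ∀ (ν : PointMeasure d) (x : Space d), ∫⁻ y, h x *
      ({p : Space d × Space d | p.2 = p.1 + s}).indicator (1 : Space d × Space d → ℝ≥0∞) (x, y) ∂ν.toMeasure =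
      h x * ν.toMeasure {x + s} := by
    intro ν x
    have : (fun y => ({p : Space d × Space d | p.2 = p.1 + s}).indicator (1 : Space d × Space d → ℝ≥0∞) (x, y)) =
        ({x + s} : Set (Space d)).indicator 1 := by
      ext y; simp [indicator_apply]
    have hm1 : Measurable fun y => ({p : Space d × Space d | p.2 = p.1 + s}).indicator
        (1 : Space d × Space d → ℝ≥0∞) (x, y) :=
      (measurable_one.indicator hS).comp measurable_prodMk_left
    rw [lintegral_const_mul _ hm1, this,
      lintegral_indicator_one (measurableSet_singleton _)]
  have e2 : ∀ z : Space d, ∫⁻ x, h x *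
      ({p : Space d × Space d | p.2 = p.1 + s}).indicator (1 : Space d × Space d → ℝ≥0∞) (x, x + z) =
      ({s} : Set (Space d)).indicator 1 z * ∫⁻ x, h x := by
    intro z
    rw [← lintegral_const_mul _ hm]
    refine lintegral_congr fun x => ?_
    rw [mul_comm]
    congr 1
    simp [indicator_apply]
  simp_rw [e1, e2] at key
  rw [key, lintegral_mul_const _ (measurable_one.indicator (measurableSet_singleton s)),
    lintegral_indicator_one (measurableSet_singleton s)]

/-- Campbell's formula. -/
theorem lintegral_lintegral_eq (hst : IsStationaryLaw μ) (hr : 0 < r)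
    (hud : ∀ᵐ ν ∂μ, IsUniformlyDiscrete r ν) {h : Space d → ℝ≥0∞} (hm : Measurable h) :
    ∫⁻ ν, ∫⁻ x, h x ∂ν.toMeasure ∂μ = firstMoment (palmMeasure μ) {0} * ∫⁻ x, h x := by
  -- The case s = 0: points have mass one, so the atom of ω at 0 is the intensity.
  rw [← lintegral_mul_measure_singleton_add hst hm]
  refine lintegral_congr_ae (hud.mono fun ν hν => ?_)
  refine lintegral_congr_ae ?_
  filter_upwards [measure_eq_zero_iff_ae_notMem.1 ν.measure_compl_points] with x hx
  rw [add_zero, hν.measure_singleton hr, indicator_of_mem (not_notMem.1 hx), Pi.one_apply, mul_one]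

theorem lintegral_enorm_linearStatistic_sub_add_le (hst : IsStationaryLaw μ) (hr : 0 < r)
    (hud : ∀ᵐ ν ∂μ, IsUniformlyDiscrete r ν) (φ : 𝓢(Space d, ℂ)) (t : Space d) :
    ∫⁻ ν, ‖linearStatistic φ ν - linearStatistic φ (PointMeasure.translate t ν)‖ₑ ∂μ +
      2 * (firstMoment (palmMeasure μ) {t} * ∫⁻ x, ‖φ x‖ₑ) ≤
      2 * (firstMoment (palmMeasure μ) {0} * ∫⁻ x, ‖φ x‖ₑ) := by
  have hφ : Measurable fun x => ‖φ x‖ₑ := φ.continuous.measurable.enorm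
  have hφt : Measurable fun x => ‖φ (t + x)‖ₑ := hφ.comp (measurable_const_add t)
  have hI : ∫⁻ x, ‖φ (t + x)‖ₑ = ∫⁻ x, ‖φ x‖ₑ :=
    lintegral_add_left_eq_self (fun x => ‖φ x‖ₑ) t
  have hU : ∫⁻ ν, ∫⁻ x in ν.points, ‖φ x‖ₑ ∂(PointMeasure.translate t ν).toMeasure ∂μ =
      firstMoment (palmMeasure μ) {t} * ∫⁻ x, ‖φ x‖ₑ := by
    rw [← hI, ← lintegral_mul_measure_singleton_add hst hφt]
    refine lintegral_congr_ae (hud.mono fun ν hν => ?_)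
    simp only
    rw [← lintegral_indicator ν.measurableSet_points, lintegral_translate]
    refine lintegral_congr fun x => ?_
    rw [hν.measure_singleton hr, add_comm x t]
    by_cases hx : t + x ∈ ν.points <;> simp [hx]
  have hV : ∫⁻ ν, ∫⁻ x, ‖φ x‖ₑ ∂(PointMeasure.translate t ν).toMeasure ∂μ =
      firstMoment (palmMeasure μ) {0} * ∫⁻ x, ‖φ x‖ₑ := by
    simp_rw [lintegral_translate]
    rw [lintegral_lintegral_eq hst hr hud hφt, hI]
  calc _ ≤ ∫⁻ ν, (‖linearStatistic φ ν - linearStatistic φ (PointMeasure.translate t ν)‖ₑ +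
        (∫⁻ x in ν.points, ‖φ x‖ₑ ∂(PointMeasure.translate t ν).toMeasure +
        ∫⁻ x in ν.points, ‖φ x‖ₑ ∂(PointMeasure.translate t ν).toMeasure)) ∂μ := by
        -- Superadditivity of the lower integral holds for arbitrary functions, so measurability of
        -- the restricted integrals in ν is not needed.
        refine le_trans ?_ (le_lintegral_add _ _)
        refine add_le_add le_rfl (le_trans ?_ (le_lintegral_add _ _))
        rw [hU, two_mul]
    _ ≤ ∫⁻ ν, (∫⁻ x, ‖φ x‖ₑ ∂ν.toMeasure +
        ∫⁻ x, ‖φ x‖ₑ ∂(PointMeasure.translate t ν).toMeasure) ∂μ :=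
        lintegral_mono_ae (hud.mono fun ν hν => enorm_integral_sub_add_le hr hν (hν.translate t) φ)
    _ = _ := by
        rw [lintegral_add_left, hV, lintegral_lintegral_eq hst hr hud hφ, two_mul]
        exact measurable_lintegral (g := fun ν => ν) measurable_id (f := fun _ x => ‖φ x‖ₑ)
          (hφ.comp measurable_snd)

end Difference

/-! ### Eigenfunctions from Gaussians concentrating at k. -/

section Eigenfunction

open PointMeasure ProbabilityTheory Filter Topology

variable {d : ℕ}

theorem tendsto_eLpNorm_two_of_dominated {α : Type*} [MeasurableSpace α] {σ : Measure α}
    {F : ℕ → α → ℂ} {B : α → ℂ} (hF : ∀ n, AEStronglyMeasurable (F n) σ) (hB : MemLp B 2 σ)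
    (hFB : ∀ n x, ‖F n x‖ ≤ ‖B x‖) (hlim : ∀ x, Tendsto (fun n => F n x) atTop (𝓝 0)) :
    Tendsto (fun n => eLpNorm (F n) 2 σ) atTop (𝓝 0) := by
  have h1 : Tendsto (fun n => ∫⁻ x, ‖F n x‖ₑ ^ (2 : ℝ) ∂σ) atTop (𝓝 (∫⁻ _, 0 ∂σ)) := by
    refine tendsto_lintegral_of_dominated_convergence' (fun x => ‖B x‖ₑ ^ (2 : ℝ))
      (fun n => (hF n).enorm.pow_const _) (fun n => ae_of_all _ fun x => ?_) ?_
      (ae_of_all _ fun x => ?_)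
    · exact ENNReal.rpow_le_rpow (enorm_le_iff_norm_le.2 (hFB n x)) zero_le_two
    · have := lintegral_rpow_enorm_lt_top_of_eLpNorm_lt_top two_ne_zero ENNReal.ofNat_ne_top
        hB.eLpNorm_lt_top
      simpa using this.ne
    · have := ((ENNReal.continuous_rpow_const (y := 2)).tendsto _).comp (hlim x).enorm
      simpa [Function.comp_def] using this
  have h2 := ((ENNReal.continuous_rpow_const (y := 1 / 2)).tendsto _).comp h1
  simp_rw [eLpNorm_eq_lintegral_rpow_enorm_toReal two_ne_zero ENNReal.ofNat_ne_top]
  simpa [Function.comp_def] using h2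

theorem eLpNorm_le_sub_add {α : Type*} [MeasurableSpace α] {σ : Measure α} {f g : α → ℂ} {p : ℝ≥0∞}
    (hf : AEStronglyMeasurable f σ) (hg : AEStronglyMeasurable g σ) (hp : 1 ≤ p) :
    eLpNorm f p σ ≤ eLpNorm (f - g) p σ + eLpNorm g p σ := by
  simpa using eLpNorm_add_le (hf.sub hg) hg hp

/-- Gaussians concentrating at the frequency `k`. -/
noncomputable def peak (k : Space d) (n : ℕ) : 𝓢(Space d, ℂ) :=
  SchwartzMap.compSubConstCLM ℂ k (gaussian ((n : ℝ) + 1) n.cast_add_one_pos)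

theorem norm_peak_apply (k : Space d) (n : ℕ) (ξ : Space d) :
    ‖peak k n ξ‖ = Real.exp (-((n : ℝ) + 1) * ‖ξ - k‖ ^ 2) :=
  norm_gaussian_apply _ _ _

theorem peak_self (k : Space d) (n : ℕ) : peak k n k = 1 := by
  simp [peak, gaussian_apply]

theorem norm_peak_le (k : Space d) (n : ℕ) (ξ : Space d) : ‖peak k n ξ‖ ≤ ‖peak k 0 ξ‖ := by
  rw [norm_peak_apply, norm_peak_apply]
  gcongr
  exact n.zero_le

theorem tendsto_peak (k ξ : Space d) (h : ξ ≠ k) :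
    Tendsto (fun n => peak k n ξ) atTop (𝓝 0) := by
  rw [tendsto_zero_iff_norm_tendsto_zero]
  simp_rw [norm_peak_apply]
  refine Real.tendsto_exp_atBot.comp ?_
  have hpos : 0 < ‖ξ - k‖ ^ 2 := by
    have := norm_pos_iff.2 (sub_ne_zero.2 h)
    positivity
  refine Tendsto.atBot_mul_const hpos (tendsto_neg_atTop_atBot.comp ?_)
  exact tendsto_atTop_add_const_right _ _ tendsto_natCast_atTop_atTop

theorem lintegral_enorm_fourier_peak (k : Space d) (n : ℕ) :
    ∫⁻ x, ‖𝓕 (peak k n) x‖ₑ = 1 := by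
  have h := integral_norm_fourier_gaussian (d := d) ((n : ℝ) + 1) n.cast_add_one_pos
  have h2 := ofReal_integral_norm_eq_lintegral_enorm ((𝓕 (peak k n)).integrable (μ := volume))
  rw [← h2]
  simp_rw [peak, norm_fourier_compSubConstCLM, h, ENNReal.ofReal_one]

/-- Dominated convergence: the peaks equal 1 at k, vanish in the limit elsewhere, and stay below
`peak k 0`, which lies in L²(σ) even when σ is infinite. -/
theorem tendsto_eLpNorm_peak_sub {σ : Measure (Space d)} [σ.HasTemperateGrowth] (k : Space d) :
    Tendsto (fun n => eLpNorm (fun ξ => peak k n ξ - ({k} : Set (Space d)).indicator 1 ξ) 2 σ)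
      atTop (𝓝 0) := by
  have hind : StronglyMeasurable (({k} : Set (Space d)).indicator (1 : Space d → ℂ)) :=
    stronglyMeasurable_one.indicator (measurableSet_singleton k)
  refine tendsto_eLpNorm_two_of_dominated
    (fun n => (peak k n).continuous.aestronglyMeasurable.sub hind.aestronglyMeasurable)
    ((peak k 0).memLp 2 σ) (fun n ξ => ?_) (fun ξ => ?_)
  · by_cases h : ξ = k
    · subst h; simp [peak_self]
    · simpa [h] using norm_peak_le k n ξ
  · by_cases h : ξ = k
    · subst h; simp [peak_self]
    · simpa [h] using tendsto_peak k ξ h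

/-- At k the two functions agree, and away from k both tend to 0; this becomes the eigenvalue
equation. -/
theorem tendsto_eLpNorm_modulate_peak_sub {σ : Measure (Space d)} [σ.HasTemperateGrowth]
    (k t : Space d) :
    Tendsto (fun n => eLpNorm (modulate t (peak k n) -
      (Real.fourierChar (-inner ℝ k t) : ℂ) • peak k n : 𝓢(Space d, ℂ)) 2 σ) atTop (𝓝 0) := by
  refine tendsto_eLpNorm_two_of_dominated (fun n => (SchwartzMap.continuous _).aestronglyMeasurable)
    (((peak k 0).memLp 2 σ).const_mul 2) (fun n ξ => ?_) (fun ξ => ?_)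
  · refine (norm_sub_le _ _).trans ?_
    rw [norm_modulate_apply, smul_apply, norm_smul, Circle.norm_coe, one_mul, norm_mul,
      Complex.norm_two]
    linarith [norm_peak_le k n ξ]
  · simp only [sub_apply, smul_apply, modulate_apply, smul_eq_mul]
    by_cases h : ξ = k
    · subst h; simp
    · have := tendsto_peak k ξ h
      simpa using (this.const_mul _).sub (this.const_mul _)

variable {μ : Measure (PointMeasure d)} {r : ℝ}

theorem linearStatistic_fourier_sub_smul (hr : 0 < r) (hud : ∀ᵐ ν ∂μ, IsUniformlyDiscrete r ν)
    (f g : 𝓢(Space d, ℂ)) (e : ℂ) :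
    (linearStatistic (𝓕 (f - e • g))) =ᵐ[μ]
      fun ν => linearStatistic (𝓕 f) ν - e * linearStatistic (𝓕 g) ν := by
  refine hud.mono fun ν hν => ?_
  have := hν.hasTemperateGrowth hr
  have h : 𝓕 (f - e • g) = 𝓕 f - e • 𝓕 g := by
    simpa using (FourierTransform.fourierCLM ℂ 𝓢(Space d, ℂ)).map_sub f (e • g)
  simp only [linearStatistic, h, sub_apply, smul_apply, smul_eq_mul]
  rw [integral_sub (SchwartzMap.integrable _) ((SchwartzMap.integrable _).const_mul e),
    integral_const_mul]

theorem linearStatistic_fourier_translate (f : 𝓢(Space d, ℂ)) (t : Space d) (ν : PointMeasure d) :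
    linearStatistic (𝓕 f) (PointMeasure.translate t ν) = linearStatistic (𝓕 (modulate t f)) ν := by
  rw [linearStatistic_translate, modulate, FourierTransform.fourier_fourierInv_eq]

variable [IsProbabilityMeasure μ]

/-- The linear statistics of concentrating Gaussians converge in `L²` to an eigenfunction `c` of
the translation action, with `‖c‖² = σ {k}`. -/
theorem exists_eigenfunction (hst : IsStationaryLaw μ) (hr : 0 < r)
    (hud : ∀ᵐ ν ∂μ, IsUniformlyDiscrete r ν) {σ : Measure (Space d)}
    (hσ : IsFourierTransform (firstMoment (palmMeasure μ)) σ) (k : Space d) :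
    ∃ c : PointMeasure d → ℂ, StronglyMeasurable c ∧ MemLp c 2 μ ∧
      Tendsto (fun n => eLpNorm (linearStatistic (𝓕 (peak k n)) - c) 2 μ) atTop (𝓝 0) ∧
      eLpNorm c 2 μ = eLpNorm (({k} : Set (Space d)).indicator (1 : Space d → ℂ)) 2 σ ∧
      ∀ t : Space d, ∀ᵐ ν ∂μ, c (PointMeasure.translate t ν) =
        Real.fourierChar (-inner ℝ k t) * c ν := by
  have := hσ.temperate_right
  let N : ℕ → PointMeasure d → ℂ := fun n => linearStatistic (𝓕 (peak k n))
  let I : Space d → ℂ := ({k} : Set (Space d)).indicator 1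
  have hN : ∀ n, MemLp (N n) 2 μ := fun n => memLp_linearStatistic hr hud _ 2
  have hI : AEStronglyMeasurable I σ :=
    (stronglyMeasurable_one.indicator (measurableSet_singleton k)).aestronglyMeasurable
  have hiso : ∀ f : 𝓢(Space d, ℂ), eLpNorm (linearStatistic (𝓕 f)) 2 μ = eLpNorm f 2 σ :=
    eLpNorm_linearStatistic_fourier hst hr hud hσ
  have hpI := tendsto_eLpNorm_peak_sub (σ := σ) k
  have hpI' : ∀ n, eLpNorm (fun ξ => peak k n ξ - I ξ) 2 σ = eLpNorm (⇑(peak k n) - I) 2 σ :=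
    fun n => rfl
  have hsub : ∀ m n, eLpNorm (N m - N n) 2 μ ≤
      eLpNorm (fun ξ => peak k m ξ - I ξ) 2 σ + eLpNorm (fun ξ => peak k n ξ - I ξ) 2 σ := by
    intro m n
    -- The isometry transports the Cauchy property of the peaks in L²(σ) to their linear statistics.
    have h1 : N m - N n =ᵐ[μ] linearStatistic (𝓕 (peak k m - (1 : ℂ) • peak k n)) := by
      filter_upwards [linearStatistic_fourier_sub_smul hr hud (peak k m) (peak k n) 1] with ν hν
      rw [hν, one_mul]; rfl
    rw [eLpNorm_congr_ae h1, hiso]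
    have h2 : ⇑(peak k m - (1 : ℂ) • peak k n) =
        (fun ξ => peak k m ξ - I ξ) - fun ξ => peak k n ξ - I ξ := by
      ext ξ
      simp
    rw [h2]
    exact eLpNorm_sub_le ((peak k m).continuous.aestronglyMeasurable.sub hI)
      ((peak k n).continuous.aestronglyMeasurable.sub hI) one_le_two
  have hcau : CauchySeq fun n => (hN n).toLp (N n) := by
    rw [EMetric.cauchySeq_iff]
    intro ε hε
    obtain ⟨n₀, hn₀⟩ := (hpI.eventually (gt_mem_nhds (ENNReal.half_pos hε.ne'))).exists_forall_of_atTop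
    refine ⟨n₀, fun m hm n hn => ?_⟩
    rw [Lp.edist_toLp_toLp]
    refine (hsub m n).trans_lt ?_
    rw [← ENNReal.add_halves ε]
    exact ENNReal.add_lt_add (hn₀ m hm) (hn₀ n hn)
  obtain ⟨cL, hcL⟩ := cauchySeq_tendsto_of_complete hcau
  let c : PointMeasure d → ℂ := cL
  have hcm : StronglyMeasurable c := Lp.stronglyMeasurable cL
  have hc2 : MemLp c 2 μ := Lp.memLp cL
  have hlim : Tendsto (fun n => eLpNorm (N n - c) 2 μ) atTop (𝓝 0) := by
    have := (Lp.tendsto_Lp_iff_tendsto_eLpNorm' _ _).1 hcL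
    refine this.congr fun n => eLpNorm_congr_ae ?_
    filter_upwards [(hN n).coeFn_toLp] with ν hν
    simp [hν, c]
  refine ⟨c, hcm, hc2, hlim, ?_, fun t => ?_⟩
  · have h1 : ∀ n, eLpNorm c 2 μ ≤ eLpNorm (N n - c) 2 μ +
        eLpNorm (fun ξ => peak k n ξ - I ξ) 2 σ + eLpNorm I 2 σ := by
      intro n
      rw [add_assoc]
      refine (eLpNorm_le_sub_add hc2.1 (hN n).1 one_le_two).trans ?_
      rw [eLpNorm_sub_comm, hiso (peak k n)]
      gcongr
      exact eLpNorm_le_sub_add (peak k n).continuous.aestronglyMeasurable hI one_le_two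
    have h2 : ∀ n, eLpNorm I 2 σ ≤ eLpNorm (fun ξ => peak k n ξ - I ξ) 2 σ +
        eLpNorm (N n - c) 2 μ + eLpNorm c 2 μ := by
      intro n
      rw [add_assoc]
      refine (eLpNorm_le_sub_add hI (peak k n).continuous.aestronglyMeasurable one_le_two).trans ?_
      rw [eLpNorm_sub_comm, ← hiso (peak k n)]
      gcongr
      · exact le_rfl
      · exact eLpNorm_le_sub_add (hN n).1 hc2.1 one_le_two
    refine le_antisymm ?_ ?_
    · refine ge_of_tendsto' (x := atTop) ?_ h1
      have := (hlim.add hpI).add_const (eLpNorm I 2 σ)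
      rwa [add_zero, zero_add] at this
    · refine ge_of_tendsto' (x := atTop) ?_ h2
      have := (hpI.add hlim).add_const (eLpNorm c 2 μ)
      rwa [add_zero, zero_add] at this
  · let e : ℂ := Real.fourierChar (-inner ℝ k t)
    let T : PointMeasure d → PointMeasure d := PointMeasure.translate t
    have hT : MeasurePreserving T μ μ := hst t
    have hcT : AEStronglyMeasurable (c ∘ T) μ := (hcm.comp_measurable hT.measurable).aestronglyMeasurable
    have hNT : ∀ n, AEStronglyMeasurable (N n ∘ T) μ := fun n =>
      ((stronglyMeasurable_linearStatistic _).comp_measurable hT.measurable).aestronglyMeasurable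
    have hmod := tendsto_eLpNorm_modulate_peak_sub (σ := σ) k t
    -- Compare c ∘ T with N_n ∘ T, then with e N_n, then with e c. The outer terms use invariance of
    -- μ and |e| = 1; the middle one is the modulation error in L²(σ).
    have h1 : ∀ n, eLpNorm (c ∘ T - fun ν => e * c ν) 2 μ ≤ eLpNorm (N n - c) 2 μ +
        (eLpNorm (modulate t (peak k n) - e • peak k n : 𝓢(Space d, ℂ)) 2 σ +
          eLpNorm (N n - c) 2 μ) := by
      intro n
      have e1 : eLpNorm (c ∘ T - N n ∘ T) 2 μ = eLpNorm (N n - c) 2 μ := by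
        rw [eLpNorm_sub_comm]
        exact eLpNorm_comp_measurePreserving ((hN n).1.sub hc2.1) hT
      have e2 : eLpNorm (N n ∘ T - fun ν => e * N n ν) 2 μ =
          eLpNorm (modulate t (peak k n) - e • peak k n : 𝓢(Space d, ℂ)) 2 σ := by
        rw [← hiso]
        refine eLpNorm_congr_ae ?_
        filter_upwards [linearStatistic_fourier_sub_smul hr hud (modulate t (peak k n))
          (peak k n) e] with ν hν
        rw [hν, ← linearStatistic_fourier_translate]
        rfl
      have e3 : eLpNorm ((fun ν => e * N n ν) - fun ν => e * c ν) 2 μ = eLpNorm (N n - c) 2 μ := by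
        refine eLpNorm_congr_norm_ae (ae_of_all _ fun ν => ?_)
        simp only [Pi.sub_apply, ← mul_sub, norm_mul, e, Circle.norm_coe, one_mul]
      have e4 : c ∘ T - (fun ν => e * c ν) = (c ∘ T - N n ∘ T) + ((N n ∘ T - fun ν => e * N n ν) +
          ((fun ν => e * N n ν) - fun ν => e * c ν)) := by
        ext ν; simp
      have hNe : AEStronglyMeasurable (fun ν => e * N n ν) μ := (hN n).1.const_mul e
      have hce : AEStronglyMeasurable (fun ν => e * c ν) μ := hc2.1.const_mul e
      rw [e4, ← e2]
      refine (eLpNorm_add_le (hcT.sub (hNT n)) (((hNT n).sub hNe).add (hNe.sub hce))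
        one_le_two).trans ?_
      rw [e1]
      gcongr
      refine (eLpNorm_add_le ((hNT n).sub hNe) (hNe.sub hce) one_le_two).trans ?_
      rw [e3]
    have h2 : eLpNorm (c ∘ T - fun ν => e * c ν) 2 μ ≤ 0 := by
      refine ge_of_tendsto' (x := atTop) ?_ h1
      simpa using hlim.add (hmod.add hlim)
    have h3 := (eLpNorm_eq_zero_iff (hcT.sub (hc2.1.const_mul e)) two_ne_zero).1
      (le_antisymm h2 zero_le)
    filter_upwards [h3] with ν hν
    exact sub_eq_zero.1 hν

end Eigenfunction

/-! ### The inequality. -/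

section Inequality

open PointMeasure ProbabilityTheory Filter Topology

variable {d : ℕ} {μ : Measure (PointMeasure d)} [IsProbabilityMeasure μ] {r : ℝ}

theorem eLpNorm_indicator_singleton (σ : Measure (Space d)) (k : Space d) :
    eLpNorm (({k} : Set (Space d)).indicator (1 : Space d → ℂ)) 2 σ = σ {k} ^ (1 / 2 : ℝ) := by
  have := eLpNorm_indicator_const (μ := σ) (c := (1 : ℂ)) (measurableSet_singleton k)
    two_ne_zero ENNReal.ofNat_ne_top
  simpa [Pi.one_def] using this

/-- By ergodicity an eigenfunction has almost surely constant modulus. -/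
theorem IsErgodicLaw.ae_norm_eq_sqrt (he : IsErgodicLaw μ) {σ : Measure (Space d)} {k : Space d}
    {c : PointMeasure d → ℂ} (hcm : StronglyMeasurable c)
    (hcσ : eLpNorm c 2 μ = eLpNorm (({k} : Set (Space d)).indicator (1 : Space d → ℂ)) 2 σ)
    (hinv : ∀ t : Space d, ∀ᵐ ν ∂μ, c (PointMeasure.translate t ν) =
      Real.fourierChar (-inner ℝ k t) * c ν) :
    ∀ᵐ ν ∂μ, ‖c ν‖ = √(σ.real {k}) := by
  obtain ⟨M, hM⟩ := he.exists_ae_eq_const (g := fun ν => ‖c ν‖) hcm.measurable.norm fun t => by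
    filter_upwards [hinv t] with ν hν
    rw [hν, norm_mul, Circle.norm_coe, one_mul]
  have hM0 : 0 ≤ M := by
    obtain ⟨ν, hν⟩ := hM.exists
    exact hν ▸ norm_nonneg _
  have h1 : eLpNorm c 2 μ = ENNReal.ofReal M := by
    rw [eLpNorm_congr_norm_ae (g := fun _ => M) (by
      filter_upwards [hM] with ν hν
      rw [hν, Real.norm_of_nonneg hM0]), eLpNorm_const _ two_ne_zero (IsProbabilityMeasure.ne_zero μ)]
    simp [Real.enorm_of_nonneg hM0]
  rw [eLpNorm_indicator_singleton, h1] at hcσ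
  have h2 : M = √(σ.real {k}) := by
    have := congrArg ENNReal.toReal hcσ
    rwa [ENNReal.toReal_ofReal hM0, ← ENNReal.toReal_rpow, ← Real.sqrt_eq_rpow] at this
  rwa [← h2]

/-- On a probability space L² convergence implies L¹ convergence, so the bound for the statistics,
whose test functions have L¹ norm 1, passes to their limit c. -/
theorem lintegral_enorm_eigenfunction_sub_add_le (hst : IsStationaryLaw μ) (hr : 0 < r)
    (hud : ∀ᵐ ν ∂μ, IsUniformlyDiscrete r ν) {k : Space d} {c : PointMeasure d → ℂ}
    (hc2 : MemLp c 2 μ)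
    (hlim : Tendsto (fun n => eLpNorm (linearStatistic (𝓕 (peak k n)) - c) 2 μ) atTop (𝓝 0))
    (t : Space d) :
    ∫⁻ ν, ‖c ν - c (PointMeasure.translate t ν)‖ₑ ∂μ +
      2 * firstMoment (palmMeasure μ) {t} ≤ 2 * firstMoment (palmMeasure μ) {0} := by
  let N : ℕ → PointMeasure d → ℂ := fun n => linearStatistic (𝓕 (peak k n))
  let T : PointMeasure d → PointMeasure d := PointMeasure.translate t
  have hT : MeasurePreserving T μ μ := hst t
  have hN : ∀ n, MemLp (N n) 2 μ := fun n => memLp_linearStatistic hr hud _ 2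
  have hNT : ∀ n, AEStronglyMeasurable (N n ∘ T) μ := fun n =>
    (hN n).1.comp_measurePreserving hT
  have hcT : AEStronglyMeasurable (c ∘ T) μ := hc2.1.comp_measurePreserving hT
  have hle : ∀ n, eLpNorm (N n - c) 1 μ ≤ eLpNorm (N n - c) 2 μ := fun n =>
    eLpNorm_le_eLpNorm_of_exponent_le one_le_two ((hN n).1.sub hc2.1)
  have hbd : ∀ n, eLpNorm (N n - N n ∘ T) 1 μ + 2 * firstMoment (palmMeasure μ) {t} ≤
      2 * firstMoment (palmMeasure μ) {0} := by
    intro n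
    have := lintegral_enorm_linearStatistic_sub_add_le hst hr hud (𝓕 (peak k n)) t
    rw [lintegral_enorm_fourier_peak, mul_one, mul_one] at this
    rwa [eLpNorm_one_eq_lintegral_enorm]
  have key : ∀ n, eLpNorm (c - c ∘ T) 1 μ + 2 * firstMoment (palmMeasure μ) {t} ≤
      (eLpNorm (N n - c) 2 μ + eLpNorm (N n - c) 2 μ) +
        2 * firstMoment (palmMeasure μ) {0} := by
    intro n
    have e1 : eLpNorm (N n ∘ T - c ∘ T) 1 μ = eLpNorm (N n - c) 1 μ :=
      eLpNorm_comp_measurePreserving ((hN n).1.sub hc2.1) hT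
    have e2 : c - c ∘ T = ((N n ∘ T - c ∘ T) - (N n - c)) + (N n - N n ∘ T) := by
      abel
    refine le_trans ?_ (add_le_add_right (hbd n) _)
    rw [← add_assoc]
    gcongr
    rw [e2]
    refine (eLpNorm_add_le (((hNT n).sub hcT).sub ((hN n).1.sub hc2.1)) ((hN n).1.sub (hNT n))
      le_rfl).trans ?_
    gcongr
    refine (eLpNorm_sub_le ((hNT n).sub hcT) ((hN n).1.sub hc2.1) le_rfl).trans ?_
    rw [e1]
    exact add_le_add (hle n) (hle n)
  have h := (hlim.add hlim).add_const (2 * firstMoment (palmMeasure μ) {0})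
  rw [add_zero, zero_add] at h
  have := ge_of_tendsto' h key
  rwa [eLpNorm_one_eq_lintegral_enorm] at this

theorem norm_exp_sub_one_mul_sqrt_le (hst : IsStationaryLaw μ) (he : IsErgodicLaw μ) (hr : 0 < r)
    (hud : ∀ᵐ ν ∂μ, IsUniformlyDiscrete r ν) {σ : Measure (Space d)}
    (hσ : IsFourierTransform (firstMoment (palmMeasure μ)) σ) (k t : Space d) :
    ‖Complex.exp (2 * Real.pi * Complex.I * (inner ℝ k t : ℝ)) - 1‖ * √(σ.real {k}) ≤
      2 * ((firstMoment (palmMeasure μ)).real {0} - (firstMoment (palmMeasure μ)).real {t}) := by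
  obtain ⟨c, hcm, hc2, hlim, hcσ, hinv⟩ := exists_eigenfunction hst hr hud hσ k
  have hM := he.ae_norm_eq_sqrt hcm hcσ hinv
  have hmain := lintegral_enorm_eigenfunction_sub_add_le hst hr hud hc2 hlim t
  let e : ℂ := Complex.exp (2 * Real.pi * Complex.I * (inner ℝ k t : ℝ))
  have he1 : ‖1 - (Real.fourierChar (-inner ℝ k t) : ℂ)‖ = ‖e - 1‖ := by
    -- The eigenvalue is the inverse of the unimodular number e, and |1 − e⁻¹| = |e − 1|.
    have h : e - 1 = e * (1 - (Real.fourierChar (-inner ℝ k t) : ℂ)) := by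
      rw [Real.fourierChar_apply, mul_sub, mul_one, ← Complex.exp_add]
      congr 1
      rw [eq_comm, Complex.exp_eq_one_iff]
      refine ⟨0, ?_⟩
      push_cast
      ring
    have h2 : ‖e‖ = 1 := by
      have := Complex.norm_exp_ofReal_mul_I (2 * Real.pi * inner ℝ k t)
      rw [← this]
      simp only [e]
      congr 2
      push_cast
      ring
    rw [h, norm_mul, h2, one_mul]
  have hint : ∫⁻ ν, ‖c ν - c (PointMeasure.translate t ν)‖ₑ ∂μ =
      ENNReal.ofReal (‖e - 1‖ * √(σ.real {k})) := by
    have h : ∀ᵐ ν ∂μ, ‖c ν - c (PointMeasure.translate t ν)‖ₑ =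
        ENNReal.ofReal (‖e - 1‖ * √(σ.real {k})) := by
      filter_upwards [hM, hinv t] with ν h1 h2
      rw [h2, ← one_sub_mul, ← ofReal_norm, norm_mul, he1, h1]
    rw [lintegral_congr_ae h, lintegral_const, measure_univ, mul_one]
  obtain ⟨C, hC, hball⟩ := exists_firstMoment_ball_le hr hud
  have hfin : ∀ s : Space d, firstMoment (palmMeasure μ) {s} ≠ ∞ := fun s =>
    (((measure_mono (singleton_subset_iff.2 (Metric.mem_ball_self (half_pos hr)))).trans
      (hball s)).trans_lt hC.lt_top).ne
  rw [hint] at hmain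
  have h := ENNReal.toReal_mono (ENNReal.mul_ne_top ENNReal.ofNat_ne_top (hfin 0)) hmain
  rw [ENNReal.toReal_add ENNReal.ofReal_ne_top (ENNReal.mul_ne_top ENNReal.ofNat_ne_top (hfin t)),
    ENNReal.toReal_ofReal (by positivity), ENNReal.toReal_mul, ENNReal.toReal_mul,
    ENNReal.toReal_ofNat] at h
  simp only [Measure.real] at h ⊢
  linarith

end Inequality

theorem proposition10p1 (d : ℕ) (μ : Measure (PointMeasure d))
    (hμ : IsUniformlyDiscreteErgodicProcess μ)
    (hflc : ∀ᵐ ν ∂μ, HasFiniteLocalComplexity ν.points) :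
    (∃! σ : Measure (Space d), IsFourierTransform (firstMoment (palmMeasure μ)) σ) ∧
    ∀ σ : Measure (Space d), IsFourierTransform (firstMoment (palmMeasure μ)) σ →
      ∀ k t : Space d,
        ‖Complex.exp (2 * Real.pi * Complex.I * (inner ℝ k t : ℝ)) - 1‖ * √(σ.real {k}) ≤
          2 * ((firstMoment (palmMeasure μ)).real {0} - (firstMoment (palmMeasure μ)).real {t}) := by
  have := hμ.isProbabilityMeasure
  obtain ⟨r, hr, hud⟩ := hμ.uniformlyDiscrete
  exact ⟨existsUnique_isFourierTransform_autocorrelation hμ.stationary hr hud,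
    fun σ hσ k t => norm_exp_sub_one_mul_sqrt_le hμ.stationary hμ.ergodic hr hud hσ k t⟩
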